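/- Let $\mathbb K=\mathbb R$ or $\mathbb C$. All Banach spaces are over $\mathbb K$; a pointed metric space is a metric space with a distinguished point $0$ (a Banach space is pointed by its zero vector), and $\mathrm{Lip}_0(X;Y)$ is the set of Lipschitz maps $f\colon X\to Y$ with $f(0)=0$; $\mathrm{Lip}(f)$ is the least Lipschitz constant of $f$. A *Banach linear operator ideal* $\mathcal A$ assigns to all Banach spaces $E,F$ a linear subspace $\mathcal A(E;F)\subset\mathcal L(E;F)$ and a norm $\|\cdot\|_{\mathcal A}$ on it such that $(\mathcal A(E;F),\|\cdot\|_{\mathcal A})$ is a Banach space, $\|T\|\le\|T\|_{\mathcal A}$, $\|Id_{\mathbb K}\|_{\mathcal A}=1$, and $RTS\in\mathcal A$ with $\|RTS\|_{\mathcal A}\le\|R\|\,\|T\|_{\mathcal A}\,\|S\|$ whenever $T\in\mathcal A$ and $R,S$ are bounded operators. A *Banach Lipschitz operator ideal* $\mathcal I$ assigns to every pointed metric space $X$ and Banach space $E$ a linear subspace $\mathcal I(X;E)\subset \mathrm{Lip}_0(X;E)$ and a norm $\|\cdot\|_{\mathcal I}$ on it that makes it a Banach space, with $\mathrm{Lip}(f)\le\|f\|_{\mathcal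 I}$, $\|Id_{\mathbb K}\|_{\mathcal I}=1$, and $S\circ f\circ g\in\mathcal I$ with $\|S\circ f\circ g\|_{\mathcal I}\le \mathrm{Lip}(g)\,\|f\|_{\mathcal I}\,\|S\|$ for $g\in \mathrm{Lip}_0(Y;X)$, $f\in\mathcal I(X;E)$, $S\in\mathcal L(E;F)$. Both kinds of ideals are ordered by continuous inclusion: $\mathcal I\le\mathcal J$ iff $\mathcal I\subset\mathcal J$ and $\|\cdot\|_{\mathcal J}\le\|\cdot\|_{\mathcal I}$ on $\mathcal I$. Equality of ideals means equality of all components with equal norms (isometric equality). For a Banach linear operator ideal $\mathcal A$, let $\psi(\mathcal A)=\mathcal A\circ \mathrm{Lip}_0$ be the Banach Lipschitz operator ideal of all $f\in \mathrm{Lip}_0(X;E)$ that factor as $f=T\circ g$ with $F$ a Banach space, $g\in \mathrm{Lip}_0(X;F)$ and $T\in\mathcal A(F;E)$ (equivalently, the linearization $L_f\colon \text{\AE}(X)\to E$ on the Arens–Eells space belongs to $\mathcal A$), normed by $\|f\|_{\mathcal A\circ \mathrm{Lip}_0}=\|L_f\|_{\mathcal A}$. Here $\text{\AE}(X)$ is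 the closed linear span of the evaluations $\delta_X(x)$, $x \in X$, in the dual of $\mathrm{Lip}_0(X;\mathbb K)$, and $L_f$ is the bounded operator with $L_f\circ\delta_X=f$. The *maximal hull* $\mathcal A^{max}$ consists of the $T\in\mathcal L(E;F)$ with $$\|T\|_{\mathcal A^{max}}=\sup_{M,L}\|q_L\circ T\circ i_M\|_{\mathcal A}<\infty,$$ where $M$ runs over the finite-dimensional subspaces of $E$ (with inclusion $i_M$) and $L$ over the closed finite-codimensional subspaces of $F$ (with quotient map $q_L\colon F\to F/L$). The *maximal hull* $\mathcal I^{max}$ of a Banach Lipschitz operator ideal $\mathcal I$ consists of the $f\in \mathrm{Lip}_0(X;E)$ with $\|f\|_{\mathcal I^{max}}=\sup_{X_0,L}\|q_L\circ f\circ i_{X_0}\|_{\mathcal I}<\infty$, where $X_0$ runs over the finite subsets of $X$ that contain $0$ and $L$ over the closed finite-codimensional subspaces of $E$. Let $$CLIN_{\mathcal A}=\{\mathcal B : \mathcal B(M;N)=\mathcal A(M;N)\text{ isometrically for all finite-dimensional } M,N\},$$ $$CLIP_{\mathcal I}=\{\mathcal J : \mathcal J(X_0;N)=\mathcal I(X_0;N)\text{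 isometrically for all finite pointed } X_0 \text{ and finite-dimensional } N\}.$$ **Proposition.** For every Banach linear operator ideal $\mathcal A$, $$(\mathcal A\circ \mathrm{Lip}_0)^{max}=\psi\Big(\bigvee CLIN_{\mathcal A}\Big)=\psi(\mathcal A^{max})=\mathcal A^{max}\circ \mathrm{Lip}_0\quad\text{isometrically.}$$ Here the suprema exist, $\mathcal A^{max}=\bigvee CLIN_{\mathcal A}$ and $(\mathcal A\circ \mathrm{Lip}_0)^{max}=\bigvee CLIP_{\mathcal A\circ \mathrm{Lip}_0}$, and $\mathcal A^{max}\in CLIN_{\mathcal A}$, $(\mathcal A\circ \mathrm{Lip}_0)^{max}\in CLIP_{\mathcal A\circ \mathrm{Lip}_0}$; that is, the maximal hulls are the biggest ideals that coincide with $\mathcal A$ on finite-dimensional spaces, respectively with $\mathcal A\circ \mathrm{Lip}_0$ on finite pointed metric spaces and finite-dimensional spaces. -/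

import Mathlib

set_option maxSynthPendingDepth 3

open Filter Topology
open scoped NNReal ENNReal

universe u v

noncomputable section

namespace LipIdeals

/-! ### Pointed metric spaces and Lipschitz operators

A pointed metric space is a metric space `X` with a distinguished point `0`
(`[MetricSpace X] [Zero X]`); a normed space is pointed by its zero vector. -/

/-- The least Lipschitz constant of `f` (used for Lipschitz maps only). -/
def lipConst {X Y : Type*} [MetricSpace X] [MetricSpace Y] (f : X → Y) : ℝ≥0 :=
  sInf {K : ℝ≥0 | LipschitzWith K f}

theorem lipConst_le {X Y : Type*} [MetricSpace X] [MetricSpace Y] {f : X → Y} {K : ℝ≥0}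
    (h : LipschitzWith K f) : lipConst f ≤ K :=
  csInf_le (OrderBot.bddBelow _) h

theorem lipschitzWith_lipConst {X Y : Type*} [MetricSpace X] [MetricSpace Y] {f : X → Y}
    (h : ∃ K, LipschitzWith K f) : LipschitzWith (lipConst f) f := by
  refine LipschitzWith.of_dist_le_mul fun x y => ?_
  rcases eq_or_ne x y with rfl | hxy
  · simp
  · have hd : 0 < nndist x y := by
      rw [pos_iff_ne_zero, Ne, nndist_eq_zero]; exact hxy
    have : nndist (f x) (f y) / nndist x y ≤ lipConst f := by
      refine le_csInf h fun K hK => ?_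
      rw [div_le_iff₀ hd]
      exact_mod_cast hK.nndist_le x y
    rw [div_le_iff₀ hd] at this
    exact_mod_cast this

/-- `Lip0 X Y`: the Lipschitz maps `X → Y` that vanish at the distinguished point. -/
structure Lip0 (X : Type*) (Y : Type*) [MetricSpace X] [Zero X] [MetricSpace Y] [Zero Y] where
  toFun : X → Y
  map_zero' : toFun 0 = 0
  lipschitz' : ∃ K, LipschitzWith K toFun

namespace Lip0

section basic

variable {X Y Z : Type*} [MetricSpace X] [Zero X] [MetricSpace Y] [Zero Y]
  [MetricSpace Z] [Zero Z]

instance : FunLike (Lip0 X Y) X Y where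
  coe := toFun
  coe_injective := fun f g h => by cases f; cases g; simpa using h

@[ext] theorem ext {f g : Lip0 X Y} (h : ∀ x, f x = g x) : f = g := DFunLike.ext _ _ h

@[simp] theorem coe_mk (f : X → Y) (h h') : ⇑(Lip0.mk f h h') = f := rfl

@[simp] theorem map_zero (f : Lip0 X Y) : f 0 = 0 := f.map_zero'

/-- `Lip(f)`. -/
def lip (f : Lip0 X Y) : ℝ≥0 := lipConst f

theorem lipschitzWith (f : Lip0 X Y) : LipschitzWith f.lip f := lipschitzWith_lipConst f.lipschitz'

theorem lip_le {f : Lip0 X Y} {K : ℝ≥0} (h : LipschitzWith K f) : f.lip ≤ K := lipConst_le h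

/-- The identity of a pointed metric space. -/
def id (X : Type*) [MetricSpace X] [Zero X] : Lip0 X X := ⟨fun x => x, rfl, 1, LipschitzWith.id⟩

@[simp] theorem id_apply (x : X) : Lip0.id X x = x := rfl

/-- Composition of Lipschitz maps. -/
def comp (g : Lip0 Y Z) (f : Lip0 X Y) : Lip0 X Z :=
  ⟨fun x => g (f x), by simp, g.lip * f.lip, g.lipschitzWith.comp f.lipschitzWith⟩

@[simp] theorem comp_apply (g : Lip0 Y Z) (f : Lip0 X Y) (x : X) : g.comp f x = g (f x) := rfl

theorem lip_comp_le (g : Lip0 Y Z) (f : Lip0 X Y) : (g.comp f).lip ≤ g.lip * f.lip :=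
  lip_le (g.lipschitzWith.comp f.lipschitzWith)

end basic

section vector

variable {X : Type*} [MetricSpace X] [Zero X] {E : Type*} [NormedAddCommGroup E]
  {𝕜 : Type*} [RCLike 𝕜] [NormedSpace 𝕜 E]

theorem lipschitzWith_const_smul (c : 𝕜) (f : Lip0 X E) :
    LipschitzWith (‖c‖₊ * f.lip) (fun x => c • f x) := by
  refine LipschitzWith.of_dist_le_mul fun x y => ?_
  have h := f.lipschitzWith.dist_le_mul x y
  rw [dist_smul₀]
  push_cast
  rw [mul_assoc]
  exact mul_le_mul_of_nonneg_left h (norm_nonneg c)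

/-- The pointwise group structure (an auxiliary step towards the normed group below). -/
abbrev addCommGroupAux (X E : Type*) [MetricSpace X] [Zero X] [NormedAddCommGroup E] :
    AddCommGroup (Lip0 X E) where
  zero := ⟨fun _ => 0, rfl, 0, LipschitzWith.const 0⟩
  add f g := ⟨fun x => f x + g x, by simp, _, f.lipschitzWith.add g.lipschitzWith⟩
  neg f := ⟨fun x => -f x, by simp, _, f.lipschitzWith.neg⟩
  sub f g := ⟨fun x => f x - g x, by simp, _, f.lipschitzWith.sub g.lipschitzWith⟩
  add_assoc f g h := ext fun x => add_assoc (f x) (g x) (h x)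
  zero_add f := ext fun x => zero_add (f x)
  add_zero f := ext fun x => add_zero (f x)
  nsmul := @nsmulRec _ ⟨⟨fun _ => 0, rfl, 0, LipschitzWith.const 0⟩⟩
    ⟨fun f g => ⟨fun x => f x + g x, by simp, _, f.lipschitzWith.add g.lipschitzWith⟩⟩
  zsmul := @zsmulRec _ ⟨⟨fun _ => 0, rfl, 0, LipschitzWith.const 0⟩⟩
    ⟨fun f g => ⟨fun x => f x + g x, by simp, _, f.lipschitzWith.add g.lipschitzWith⟩⟩
    ⟨fun f => ⟨fun x => -f x, by simp, _, f.lipschitzWith.neg⟩⟩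
    (@nsmulRec _ ⟨⟨fun _ => 0, rfl, 0, LipschitzWith.const 0⟩⟩
    ⟨fun f g => ⟨fun x => f x + g x, by simp, _, f.lipschitzWith.add g.lipschitzWith⟩⟩)
  neg_add_cancel f := ext fun x => neg_add_cancel (f x)
  add_comm f g := ext fun x => add_comm (f x) (g x)
  sub_eq_add_neg f g := ext fun x => sub_eq_add_neg (f x) (g x)

/-- `Lip0 X E` is a group under pointwise addition, normed by `Lip(·)`. -/
instance : NormedAddCommGroup (Lip0 X E) :=
  letI := addCommGroupAux X E
  AddGroupNorm.toNormedAddCommGroup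
    { toFun := fun f => f.lip
      map_zero' := by
        have : (0 : Lip0 X E).lip ≤ 0 := lip_le (LipschitzWith.const 0)
        simpa using this
      add_le' := fun f g => by
        exact_mod_cast lip_le (f := f + g) (f.lipschitzWith.add g.lipschitzWith)
      neg' := fun f => by
        have h : ∀ g : Lip0 X E, (-g).lip ≤ g.lip := fun g => lip_le g.lipschitzWith.neg
        have h1 := h f
        have h2 := h (-f)
        rw [neg_neg] at h2
        exact_mod_cast le_antisymm h1 h2
      eq_zero_of_map_eq_zero' := fun f hf => by
        have hf' : f.lip = 0 := by exact_mod_cast hf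
        ext x
        have h := f.lipschitzWith.dist_le_mul x 0
        rw [hf'] at h
        have h0 : f x = 0 := by simpa using h
        exact h0 }

@[simp] theorem zero_apply (x : X) : (0 : Lip0 X E) x = 0 := rfl
@[simp] theorem add_apply (f g : Lip0 X E) (x : X) : (f + g) x = f x + g x := rfl
@[simp] theorem neg_apply (f : Lip0 X E) (x : X) : (-f) x = -f x := rfl
@[simp] theorem sub_apply (f g : Lip0 X E) (x : X) : (f - g) x = f x - g x := rfl

/-- Scalars act on `Lip0 X E` pointwise. -/
instance : NormedSpace 𝕜 (Lip0 X E) where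
  smul c f := ⟨fun x => c • f x, by simp, _, lipschitzWith_const_smul c f⟩
  one_smul f := ext fun x => one_smul 𝕜 (f x)
  mul_smul a b f := ext fun x => mul_smul a b (f x)
  smul_zero a := ext fun _ => smul_zero a
  smul_add a f g := ext fun x => smul_add a (f x) (g x)
  add_smul a b f := ext fun x => add_smul a b (f x)
  zero_smul f := ext fun x => zero_smul 𝕜 (f x)
  norm_smul_le c f := by
    have := lip_le (f := ⟨fun x => c • f x, by simp, _, lipschitzWith_const_smul c f⟩)
      (lipschitzWith_const_smul c f)
    exact_mod_cast this

@[simp] theorem smul_apply (c : 𝕜) (f : Lip0 X E) (x : X) : (c • f) x = c • f x := rfl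

theorem norm_def (f : Lip0 X E) : ‖f‖ = f.lip := rfl

theorem nnnorm_def (f : Lip0 X E) : ‖f‖₊ = f.lip := rfl

theorem norm_sub_le_dist (f : Lip0 X E) (x y : X) : ‖f x - f y‖ ≤ ‖f‖ * dist x y := by
  rw [← dist_eq_norm]; exact f.lipschitzWith.dist_le_mul x y

theorem norm_apply_le (f : Lip0 X E) (x : X) : ‖f x‖ ≤ ‖f‖ * dist x 0 := by
  simpa using f.norm_sub_le_dist x 0

theorem norm_le_of {f : Lip0 X E} {C : ℝ} (hC : 0 ≤ C)
    (h : ∀ x y, ‖f x - f y‖ ≤ C * dist x y) : ‖f‖ ≤ C := by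
  have : f.lip ≤ ⟨C, hC⟩ := lip_le (LipschitzWith.of_dist_le_mul fun x y => by
    rw [dist_eq_norm]; exact h x y)
  exact_mod_cast this

/-- A continuous linear map between normed spaces, as a Lipschitz operator. -/
def ofLinear {F : Type*} [NormedAddCommGroup F] [NormedSpace 𝕜 F] (T : E →L[𝕜] F) : Lip0 E F :=
  ⟨T, by simp, _, T.lipschitz⟩

@[simp] theorem ofLinear_apply {F : Type*} [NormedAddCommGroup F] [NormedSpace 𝕜 F]
    (T : E →L[𝕜] F) (x : E) : ofLinear T x = T x := rfl

theorem norm_ofLinear_comp_le {F : Type*} [NormedAddCommGroup F] [NormedSpace 𝕜 F]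
    (T : E →L[𝕜] F) (f : Lip0 X E) : ‖(ofLinear T).comp f‖ ≤ ‖T‖ * ‖f‖ := by
  refine norm_le_of (by positivity) fun x y => ?_
  simp only [comp_apply, ofLinear_apply, ← map_sub]
  calc _ ≤ ‖T‖ * ‖f x - f y‖ := T.le_opNorm _
    _ ≤ ‖T‖ * (‖f‖ * dist x y) := by gcongr; exact f.norm_sub_le_dist x y
    _ = _ := by ring

end vector

end Lip0

/-! ### The Arens–Eells space and linearization -/

section ArensEells

variable (𝕜 : Type) [RCLike 𝕜] (X : Type u) [MetricSpace X] [Zero X]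

/-- The Dirac map `δ_X : X → (X^#)'`, `δ_X(x)(f) = f(x)`, where `X^# = Lip0 X 𝕜`. -/
def dirac (x : X) : StrongDual 𝕜 (Lip0 X 𝕜) :=
  LinearMap.mkContinuous
    { toFun := fun f => f x
      map_add' := fun _ _ => rfl
      map_smul' := fun _ _ => rfl } (dist x 0) (fun f => by
        rw [mul_comm]; exact f.norm_apply_le x)

@[simp] theorem dirac_apply (x : X) (f : Lip0 X 𝕜) : dirac 𝕜 X x f = f x := rfl

/-- The Arens–Eells (Lipschitz free) space: the closed linear span of the `δ_X(x)` in `(X^#)'`. -/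
def arensEells : Submodule 𝕜 (StrongDual 𝕜 (Lip0 X 𝕜)) :=
  (Submodule.span 𝕜 (Set.range (dirac 𝕜 X))).topologicalClosure

/-- The Arens–Eells space as a type. -/
def AE : Type u := ↥(arensEells 𝕜 X)

instance : NormedAddCommGroup (AE 𝕜 X) := inferInstanceAs (NormedAddCommGroup ↥(arensEells 𝕜 X))

instance : NormedSpace 𝕜 (AE 𝕜 X) := inferInstanceAs (NormedSpace 𝕜 ↥(arensEells 𝕜 X))

instance : CompleteSpace (AE 𝕜 X) :=
  ((Submodule.isClosed_topologicalClosure _).completeSpace_coe :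
    CompleteSpace ↥(arensEells 𝕜 X))

/-- The inclusion of `AE X` in `(X^#)'`. -/
def AE.incl : AE 𝕜 X →L[𝕜] StrongDual 𝕜 (Lip0 X 𝕜) := (arensEells 𝕜 X).subtypeL

variable {X}

theorem dirac_mem (x : X) : dirac 𝕜 X x ∈ arensEells 𝕜 X :=
  Submodule.le_topologicalClosure _ (Submodule.subset_span ⟨x, rfl⟩)

variable (X) in
/-- The Dirac map as a Lipschitz operator `X → AE X`. -/
def diracAE : Lip0 X (AE 𝕜 X) where
  toFun x := ⟨dirac 𝕜 X x, dirac_mem 𝕜 x⟩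
  map_zero' := Subtype.ext (by ext f; exact f.map_zero)
  lipschitz' := ⟨1, LipschitzWith.of_dist_le_mul fun x y => by
    refine (dist_eq_norm (E := AE 𝕜 X) _ _).trans_le ?_
    refine ContinuousLinearMap.opNorm_le_bound _ (by positivity) fun f => ?_
    have := f.norm_sub_le_dist x y
    rw [mul_comm] at this
    rw [NNReal.coe_one, one_mul]
    exact this⟩

@[simp] theorem incl_diracAE (x : X) : AE.incl 𝕜 X (diracAE 𝕜 X x) = dirac 𝕜 X x := rfl

theorem norm_incl (φ : AE 𝕜 X) : ‖AE.incl 𝕜 X φ‖ = ‖φ‖ := rfl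

theorem norm_diracAE_le : ‖diracAE 𝕜 X‖ ≤ 1 := by
  refine Lip0.norm_le_of zero_le_one fun x y => ?_
  refine ContinuousLinearMap.opNorm_le_bound _ (by positivity) fun f => ?_
  have := f.norm_sub_le_dist x y
  rw [mul_comm] at this
  rw [one_mul]
  exact this

/-- Operators on `AE X` are determined by their values on the `δ_X(x)`. -/
theorem AE.hom_ext {F : Type*} [NormedAddCommGroup F] [NormedSpace 𝕜 F] {S T : AE 𝕜 X →L[𝕜] F}
    (h : ∀ x, S (diracAE 𝕜 X x) = T (diracAE 𝕜 X x)) : S = T := by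
  let p : Submodule 𝕜 (StrongDual 𝕜 (Lip0 X 𝕜)) := Submodule.span 𝕜 (Set.range (dirac 𝕜 X))
  have hsub : ∀ (φ : StrongDual 𝕜 (Lip0 X 𝕜)) (_ : φ ∈ p),
      ∃ ψ : AE 𝕜 X, AE.incl 𝕜 X ψ = φ ∧ S ψ = T ψ := by
    intro φ hspan
    induction hspan using Submodule.span_induction with
    | mem φ hφ => obtain ⟨x, rfl⟩ := hφ; exact ⟨_, rfl, h x⟩
    | zero => exact ⟨0, by simp, by simp⟩
    | add a b ha hb iha ihb =>
      obtain ⟨a', ha', ha''⟩ := iha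
      obtain ⟨b', hb', hb''⟩ := ihb
      exact ⟨a' + b', by rw [map_add, ha', hb'], by rw [map_add, map_add, ha'', hb'']⟩
    | smul c a ha iha =>
      obtain ⟨a', ha', ha''⟩ := iha
      exact ⟨c • a', by rw [map_smul, ha'], by rw [map_smul, map_smul, ha'']⟩
  ext φ
  have hφ : AE.incl 𝕜 X φ ∈ closure (p : Set (StrongDual 𝕜 (Lip0 X 𝕜))) := φ.2
  rw [← sub_eq_zero, ← norm_eq_zero, ← _root_.sub_apply]
  refine le_antisymm (le_of_forall_pos_le_add fun ε hε => ?_) (norm_nonneg _)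
  obtain ⟨u, hu, hd⟩ := Metric.mem_closure_iff.1 hφ (ε / (‖S - T‖ + 1)) (by positivity)
  obtain ⟨ψ, rfl, hψ⟩ := hsub u hu
  have e : (S - T) φ = (S - T) (φ - ψ) := by
    rw [map_sub (S - T) φ ψ]
    simp [hψ]
  rw [dist_eq_norm, ← map_sub, norm_incl, lt_div_iff₀ (by positivity)] at hd
  rw [e, zero_add]
  refine ((S - T).le_opNorm _).trans ?_
  nlinarith [norm_nonneg (φ - ψ)]

variable {𝕜}
variable {E : Type v} [NormedAddCommGroup E] [NormedSpace 𝕜 E]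

/-- `e' ↦ e' ∘ f`, an operator `E' → X^#`. -/
def precompDual (f : Lip0 X E) : StrongDual 𝕜 E →L[𝕜] Lip0 X 𝕜 :=
  LinearMap.mkContinuous
    { toFun := fun e' => (Lip0.ofLinear e').comp f
      map_add' := fun _ _ => rfl
      map_smul' := fun _ _ => rfl } ‖f‖ (fun e' => by
        rw [mul_comm]; exact Lip0.norm_ofLinear_comp_le e' f)

theorem norm_precompDual_le (f : Lip0 X E) : ‖precompDual (𝕜 := 𝕜) f‖ ≤ ‖f‖ :=
  LinearMap.mkContinuous_norm_le _ (norm_nonneg _) _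

/-- `φ ↦ (e' ↦ φ(e' ∘ f))`, an operator `AE X → E''`. -/
def preLin (f : Lip0 X E) : AE 𝕜 X →L[𝕜] StrongDual 𝕜 (StrongDual 𝕜 E) :=
  LinearMap.mkContinuous
    { toFun := fun φ => (AE.incl 𝕜 X φ).comp (precompDual (𝕜 := 𝕜) f)
      map_add' := fun _ _ => rfl
      map_smul' := fun _ _ => rfl } ‖f‖ (fun φ => by
        refine (ContinuousLinearMap.opNorm_comp_le _ _).trans ?_
        rw [mul_comm]
        exact mul_le_mul_of_nonneg_right (norm_precompDual_le f) (norm_nonneg _))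

theorem norm_preLin_le (f : Lip0 X E) : ‖preLin (𝕜 := 𝕜) f‖ ≤ ‖f‖ :=
  LinearMap.mkContinuous_norm_le _ (norm_nonneg _) _

theorem preLin_dirac (f : Lip0 X E) (x : X) :
    preLin f (diracAE 𝕜 X x) = NormedSpace.inclusionInDoubleDualLi 𝕜 (f x) := by
  ext e'; rfl

theorem preLin_mem [CompleteSpace E] (f : Lip0 X E) (φ : AE 𝕜 X) :
    ∃ e : E, NormedSpace.inclusionInDoubleDualLi 𝕜 e = preLin f φ := by
  have hcl : IsClosed (Set.range (NormedSpace.inclusionInDoubleDualLi (E := E) 𝕜)) :=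
    ((NormedSpace.inclusionInDoubleDualLi (E := E) 𝕜).isometry.isUniformInducing.isComplete_range).isClosed
  let R : Submodule 𝕜 (StrongDual 𝕜 (StrongDual 𝕜 E)) :=
    (NormedSpace.inclusionInDoubleDualLi (E := E) 𝕜).toLinearMap.range
  have hR : IsClosed (R : Set (StrongDual 𝕜 (StrongDual 𝕜 E))) := hcl
  have : R.mkQL.comp (preLin (𝕜 := 𝕜) f) = 0 := by
    have := hR
    refine AE.hom_ext 𝕜 fun x => ?_
    rw [ContinuousLinearMap.comp_apply, preLin_dirac]
    exact (Submodule.Quotient.mk_eq_zero R).2 ⟨f x, rfl⟩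
  have h2 : R.mkQL (preLin (𝕜 := 𝕜) f φ) = 0 := congrArg (fun T => T φ) this
  exact (Submodule.Quotient.mk_eq_zero R).1 h2

variable (𝕜) in
/-- The value of the linearization of `f` at `φ`: the vector that represents
`e' ↦ φ(e' ∘ f)` in `E''`. -/
def linValue [CompleteSpace E] (f : Lip0 X E) (φ : AE 𝕜 X) : E := (preLin_mem f φ).choose

theorem inclusion_linValue [CompleteSpace E] (f : Lip0 X E) (φ : AE 𝕜 X) :
    NormedSpace.inclusionInDoubleDualLi 𝕜 (linValue 𝕜 f φ) = preLin f φ :=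
  (preLin_mem f φ).choose_spec

theorem linValue_add [CompleteSpace E] (f : Lip0 X E) (φ ψ : AE 𝕜 X) :
    linValue 𝕜 f (φ + ψ) = linValue 𝕜 f φ + linValue 𝕜 f ψ := by
  apply (NormedSpace.inclusionInDoubleDualLi (E := E) 𝕜).injective
  simp only [map_add, inclusion_linValue]

theorem linValue_smul [CompleteSpace E] (f : Lip0 X E) (c : 𝕜) (φ : AE 𝕜 X) :
    linValue 𝕜 f (c • φ) = c • linValue 𝕜 f φ := by
  apply (NormedSpace.inclusionInDoubleDualLi (E := E) 𝕜).injective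
  simp only [map_smul, inclusion_linValue]

theorem norm_linValue_le [CompleteSpace E] (f : Lip0 X E) (φ : AE 𝕜 X) :
    ‖linValue 𝕜 f φ‖ ≤ ‖f‖ * ‖φ‖ := by
  rw [← (NormedSpace.inclusionInDoubleDualLi (E := E) 𝕜).norm_map, inclusion_linValue]
  exact (preLin (𝕜 := 𝕜) f).le_of_opNorm_le (norm_preLin_le (𝕜 := 𝕜) f) φ

variable (𝕜) in
/-- The linearization as a linear map. -/
def linLinear [CompleteSpace E] (f : Lip0 X E) : AE 𝕜 X →ₗ[𝕜] E where
  toFun φ := linValue 𝕜 f φ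
  map_add' φ ψ := linValue_add f φ ψ
  map_smul' c φ := linValue_smul f c φ

variable (𝕜) in
/-- The linearization `L_f : AE X → E` of `f`: the unique operator with `L_f ∘ δ_X = f`. -/
def linearization [CompleteSpace E] (f : Lip0 X E) : AE 𝕜 X →L[𝕜] E :=
  LinearMap.mkContinuous (linLinear 𝕜 f) ‖f‖ (norm_linValue_le f)

@[simp] theorem linearization_dirac [CompleteSpace E] (f : Lip0 X E) (x : X) :
    linearization 𝕜 f (diracAE 𝕜 X x) = f x :=
  (NormedSpace.inclusionInDoubleDualLi (E := E) 𝕜).injective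
    ((inclusion_linValue f (diracAE 𝕜 X x)).trans (preLin_dirac f x))

theorem linearization_unique [CompleteSpace E] {f : Lip0 X E} {T : AE 𝕜 X →L[𝕜] E}
    (h : ∀ x, T (diracAE 𝕜 X x) = f x) : linearization 𝕜 f = T :=
  AE.hom_ext 𝕜 fun x => by rw [h, linearization_dirac]

theorem norm_linearization [CompleteSpace E] (f : Lip0 X E) : ‖linearization 𝕜 f‖ = ‖f‖ := by
  apply le_antisymm
  · exact LinearMap.mkContinuous_norm_le _ (norm_nonneg _) _
  · refine Lip0.norm_le_of (norm_nonneg _) fun x y => ?_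
    rw [← linearization_dirac (𝕜 := 𝕜) f x, ← linearization_dirac (𝕜 := 𝕜) f y, ← map_sub]
    refine (ContinuousLinearMap.le_opNorm _ _).trans ?_
    gcongr
    refine ((diracAE 𝕜 X).norm_sub_le_dist x y).trans ?_
    exact (mul_le_mul_of_nonneg_right (norm_diracAE_le 𝕜) dist_nonneg).trans (one_mul _).le

end ArensEells

/-! ### Complete norms with values in `[0, ∞]` -/

/-- `N : V → [0, ∞]` presents a normed space: the linear subspace `{v | N v < ∞}` of `V`, normed
by `N`, is a Banach space. -/
structure IsBanachENorm (𝕜 : Type) [RCLike 𝕜] {V : Type*} [AddCommGroup V] [Module 𝕜 V]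
    (N : V → ℝ≥0∞) : Prop where
  eq_zero : ∀ v, N v = 0 → v = 0
  add_le : ∀ v w, N (v + w) ≤ N v + N w
  smul : ∀ (c : 𝕜) v, N (c • v) = ‖c‖ₑ * N v
  complete : ∀ u : ℕ → V, (∀ n, N (u n) < ∞) →
    (∀ ε : ℝ≥0∞, 0 < ε → ∃ K, ∀ m ≥ K, ∀ n ≥ K, N (u m - u n) ≤ ε) →
    ∃ v, N v < ∞ ∧ Tendsto (fun n => N (u n - v)) atTop (𝓝 0)

theorem IsBanachENorm.neg {𝕜 : Type} [RCLike 𝕜] {V : Type*} [AddCommGroup V] [Module 𝕜 V]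
    {N : V → ℝ≥0∞} (h : IsBanachENorm 𝕜 N) (v : V) : N (-v) = N v := by
  have := h.smul (-1) v
  simpa using this

/-- The supremum of a family of complete norms, each on the image of a contraction, is a complete
norm provided that it dominates the norm of the (complete) space. -/
theorem IsBanachENorm.iSup {𝕜 : Type} [RCLike 𝕜] {V : Type*} [NormedAddCommGroup V]
    [NormedSpace 𝕜 V] [CompleteSpace V] {ι : Type*} {W : ι → Type*}
    [∀ i, NormedAddCommGroup (W i)] [∀ i, NormedSpace 𝕜 (W i)]
    (Φ : ∀ i, V →ₗ[𝕜] W i) (hΦ : ∀ i v, ‖Φ i v‖ ≤ ‖v‖)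
    (N : ∀ i, W i → ℝ≥0∞) (hN : ∀ i, IsBanachENorm 𝕜 (N i)) (hdom : ∀ i w, ‖w‖ₑ ≤ N i w)
    (hlow : ∀ v, ‖v‖ₑ ≤ ⨆ i, N i (Φ i v)) :
    IsBanachENorm 𝕜 (fun v => ⨆ i, N i (Φ i v)) where
  eq_zero v hv := by
    have := hlow v
    rw [show (⨆ i, N i (Φ i v)) = 0 from hv] at this
    simpa using this
  add_le v w := iSup_le fun i => by
    rw [map_add]
    exact ((hN i).add_le _ _).trans (add_le_add (le_iSup (fun i => N i (Φ i v)) i)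
      (le_iSup (fun i => N i (Φ i w)) i))
  smul c v := by
    simp only [map_smul, (hN _).smul, ENNReal.mul_iSup]
  complete u hu hc := by
    have hcau : CauchySeq u := by
      rw [EMetric.cauchySeq_iff]
      intro ε hε
      obtain ⟨δ, hδ, hδε⟩ := exists_between hε
      obtain ⟨K, hK⟩ := hc δ hδ
      refine ⟨K, fun m hm n hn => ?_⟩
      rw [edist_eq_enorm_sub]
      exact ((hlow _).trans (hK m hm n hn)).trans_lt hδε
    obtain ⟨v, hv⟩ := cauchySeq_tendsto_of_complete hcau
    have key : ∀ ε : ℝ≥0∞, 0 < ε → ∃ K, ∀ n ≥ K, (⨆ i, N i (Φ i (u n - v))) ≤ ε := by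
      intro ε hε
      obtain ⟨K, hK⟩ := hc ε hε
      refine ⟨K, fun n hn => iSup_le fun i => ?_⟩
      obtain ⟨w, hw, hlim⟩ := (hN i).complete (fun n => Φ i (u n))
        (fun n => (le_iSup (fun i => N i (Φ i (u n))) i).trans_lt (hu n)) (fun δ hδ => by
          obtain ⟨K', hK'⟩ := hc δ hδ
          refine ⟨K', fun m hm n hn => ?_⟩
          rw [← map_sub]
          exact (le_iSup (fun i => N i (Φ i (u m - u n))) i).trans (hK' m hm n hn))
      have h1 : Tendsto (fun n => Φ i (u n)) atTop (𝓝 w) := by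
        rw [tendsto_iff_edist_tendsto_0]
        refine tendsto_of_tendsto_of_tendsto_of_le_of_le tendsto_const_nhds hlim
          (fun _ => zero_le) fun n => ?_
        rw [edist_eq_enorm_sub]
        exact hdom i _
      have h2 : Tendsto (fun n => Φ i (u n)) atTop (𝓝 (Φ i v)) :=
        (((Φ i).mkContinuous 1 (by simpa using hΦ i)).continuous.tendsto v).comp hv
      obtain rfl := tendsto_nhds_unique h1 h2
      have h3 : Tendsto (fun m => ε + N i (Φ i (u m) - Φ i v)) atTop (𝓝 (ε + 0)) :=
        tendsto_const_nhds.add hlim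
      rw [add_zero] at h3
      refine ge_of_tendsto h3 (eventually_atTop.2 ⟨K, fun m hm => ?_⟩)
      have e : Φ i (u n - v) = Φ i (u n - u m) + (Φ i (u m) - Φ i v) := by
        simp only [map_sub]; abel
      rw [e]
      exact ((hN i).add_le _ _).trans (add_le_add_left
        ((le_iSup (fun i => N i (Φ i (u n - u m))) i).trans (hK n hn m hm)) _)
    refine ⟨v, ?_, ENNReal.tendsto_atTop_zero.2 key⟩
    obtain ⟨K, hK⟩ := key 1 one_pos
    refine lt_of_le_of_lt (iSup_le fun i => ?_)
      (ENNReal.add_lt_top.2 ⟨hu K, (hK K le_rfl).trans_lt ENNReal.one_lt_top⟩)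
    have e : Φ i v = Φ i (u K) + -(Φ i (u K - v)) := by
      simp only [map_sub]; abel
    rw [e]
    refine ((hN i).add_le _ _).trans ?_
    rw [(hN i).neg]
    exact add_le_add (le_iSup (fun i => N i (Φ i (u K))) i)
      (le_iSup (fun i => N i (Φ i (u K - v))) i)

/-! ### Banach linear operator ideals and Banach Lipschitz operator ideals -/

/-- A Banach linear operator ideal `𝒜` (on all Banach spaces over `𝕜` in the universe `u`). It is
given by the ideal norm `nrm`, extended by `∞` to the operators that are not in the ideal:
`𝒜(E; F) = {T | nrm T < ∞}`. -/
structure BanachLinIdeal (𝕜 : Type) [RCLike 𝕜] : Type (u + 1) where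
  /-- The ideal norm; `∞` outside the ideal. -/
  nrm : ∀ {E F : Type u} [NormedAddCommGroup E] [NormedSpace 𝕜 E] [CompleteSpace E]
    [NormedAddCommGroup F] [NormedSpace 𝕜 F] [CompleteSpace F], (E →L[𝕜] F) → ℝ≥0∞
  /-- Every component is a linear subspace, and a Banach space in the ideal norm. -/
  banach : ∀ (E F : Type u) [NormedAddCommGroup E] [NormedSpace 𝕜 E] [CompleteSpace E]
    [NormedAddCommGroup F] [NormedSpace 𝕜 F] [CompleteSpace F],
    IsBanachENorm 𝕜 (fun T : E →L[𝕜] F => nrm T)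
  /-- `‖T‖ ≤ ‖T‖_𝒜`. -/
  enorm_le : ∀ {E F : Type u} [NormedAddCommGroup E] [NormedSpace 𝕜 E] [CompleteSpace E]
    [NormedAddCommGroup F] [NormedSpace 𝕜 F] [CompleteSpace F] (T : E →L[𝕜] F), ‖T‖ₑ ≤ nrm T
  /-- The identity of the scalar field is in the ideal, with norm one. -/
  nrm_id : nrm (ContinuousLinearMap.id 𝕜 (ULift.{u} 𝕜)) = 1
  /-- The ideal property, with its norm inequality. -/
  nrm_comp_le : ∀ {E₀ E F F₀ : Type u}
    [NormedAddCommGroup E₀] [NormedSpace 𝕜 E₀] [CompleteSpace E₀]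
    [NormedAddCommGroup E] [NormedSpace 𝕜 E] [CompleteSpace E]
    [NormedAddCommGroup F] [NormedSpace 𝕜 F] [CompleteSpace F]
    [NormedAddCommGroup F₀] [NormedSpace 𝕜 F₀] [CompleteSpace F₀]
    (R : F →L[𝕜] F₀) (T : E →L[𝕜] F) (S : E₀ →L[𝕜] E),
    nrm (R ∘L T ∘L S) ≤ ‖R‖ₑ * nrm T * ‖S‖ₑ

/-- A Banach Lipschitz operator ideal `ℐ` (on all pointed metric spaces and all Banach spaces over
`𝕜` in the universe `u`). It is given by the ideal norm `nrm`, extended by `∞` to the Lipschitz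
operators that are not in the ideal: `ℐ(X; E) = {f ∈ Lip0 X E | nrm f < ∞}`. -/
structure BanachLipIdeal (𝕜 : Type) [RCLike 𝕜] : Type (u + 1) where
  /-- The ideal norm; `∞` outside the ideal. -/
  nrm : ∀ {X E : Type u} [MetricSpace X] [Zero X]
    [NormedAddCommGroup E] [NormedSpace 𝕜 E] [CompleteSpace E], Lip0 X E → ℝ≥0∞
  /-- Every component is a linear subspace, and a Banach space in the ideal norm. -/
  banach : ∀ (X E : Type u) [MetricSpace X] [Zero X]
    [NormedAddCommGroup E] [NormedSpace 𝕜 E] [CompleteSpace E],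
    IsBanachENorm 𝕜 (fun f : Lip0 X E => nrm f)
  /-- `Lip(f) ≤ ‖f‖_ℐ`. -/
  lip_le : ∀ {X E : Type u} [MetricSpace X] [Zero X]
    [NormedAddCommGroup E] [NormedSpace 𝕜 E] [CompleteSpace E] (f : Lip0 X E),
    (f.lip : ℝ≥0∞) ≤ nrm f
  /-- The identity of the scalar field is in the ideal, with norm one. -/
  nrm_id : nrm (Lip0.id (ULift.{u} 𝕜)) = 1
  /-- The ideal property, with its norm inequality. -/
  nrm_comp_le : ∀ {Y X E F : Type u} [MetricSpace Y] [Zero Y] [MetricSpace X] [Zero X]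
    [NormedAddCommGroup E] [NormedSpace 𝕜 E] [CompleteSpace E]
    [NormedAddCommGroup F] [NormedSpace 𝕜 F] [CompleteSpace F]
    (S : E →L[𝕜] F) (f : Lip0 X E) (g : Lip0 Y X),
    nrm ((Lip0.ofLinear S).comp (f.comp g)) ≤ (g.lip : ℝ≥0∞) * nrm f * ‖S‖ₑ

namespace BanachLinIdeal

variable {𝕜 : Type} [RCLike 𝕜]

theorem nrm_injective {A B : BanachLinIdeal.{u} 𝕜}
    (h : ∀ (E F : Type u) [NormedAddCommGroup E] [NormedSpace 𝕜 E] [CompleteSpace E]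
      [NormedAddCommGroup F] [NormedSpace 𝕜 F] [CompleteSpace F] (T : E →L[𝕜] F),
      A.nrm T = B.nrm T) : A = B := by
  cases A; cases B
  congr
  funext E F i1 i2 i3 i4 i5 i6 T
  exact h E F T

/-- Continuous inclusion: `𝒜 ≤ ℬ` iff `𝒜 ⊆ ℬ` and `‖T‖_ℬ ≤ ‖T‖_𝒜` for all `T ∈ 𝒜`.
Equality in this partial order is isometric equality. -/
instance : PartialOrder (BanachLinIdeal.{u} 𝕜) where
  le A B := ∀ (E F : Type u) [NormedAddCommGroup E] [NormedSpace 𝕜 E] [CompleteSpace E]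
    [NormedAddCommGroup F] [NormedSpace 𝕜 F] [CompleteSpace F] (T : E →L[𝕜] F),
    A.nrm T < ∞ → B.nrm T < ∞ ∧ B.nrm T ≤ A.nrm T
  le_refl _ _ _ _ _ _ _ _ _ _ h := ⟨h, le_rfl⟩
  le_trans _ _ _ h1 h2 E F _ _ _ _ _ _ T h :=
    ⟨(h2 E F T (h1 E F T h).1).1, (h2 E F T (h1 E F T h).1).2.trans (h1 E F T h).2⟩
  le_antisymm A B h1 h2 := nrm_injective fun E F _ _ _ _ _ _ T => by
    rcases eq_or_ne (A.nrm T) ∞ with hA | hA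
    · rcases eq_or_ne (B.nrm T) ∞ with hB | hB
      · rw [hA, hB]
      · exact absurd hA (h2 E F T hB.lt_top).1.ne
    · exact le_antisymm (h2 E F T (h1 E F T hA.lt_top).1).2 (h1 E F T hA.lt_top).2

end BanachLinIdeal

namespace BanachLipIdeal

variable {𝕜 : Type} [RCLike 𝕜]

theorem nrm_injective {I J : BanachLipIdeal.{u} 𝕜}
    (h : ∀ (X E : Type u) [MetricSpace X] [Zero X] [NormedAddCommGroup E] [NormedSpace 𝕜 E]
      [CompleteSpace E] (f : Lip0 X E), I.nrm f = J.nrm f) : I = J := by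
  cases I; cases J
  congr
  funext X E i1 i2 i3 i4 i5 f
  exact h X E f

/-- Continuous inclusion: `ℐ ≤ 𝒥` iff `ℐ ⊆ 𝒥` and `‖f‖_𝒥 ≤ ‖f‖_ℐ` for all `f ∈ ℐ`.
Equality in this partial order is isometric equality. -/
instance : PartialOrder (BanachLipIdeal.{u} 𝕜) where
  le I J := ∀ (X E : Type u) [MetricSpace X] [Zero X] [NormedAddCommGroup E] [NormedSpace 𝕜 E]
    [CompleteSpace E] (f : Lip0 X E), I.nrm f < ∞ → J.nrm f < ∞ ∧ J.nrm f ≤ I.nrm f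
  le_refl _ _ _ _ _ _ _ _ _ h := ⟨h, le_rfl⟩
  le_trans _ _ _ h1 h2 X E _ _ _ _ _ f h :=
    ⟨(h2 X E f (h1 X E f h).1).1, (h2 X E f (h1 X E f h).1).2.trans (h1 X E f h).2⟩
  le_antisymm I J h1 h2 := nrm_injective fun X E _ _ _ _ _ f => by
    rcases eq_or_ne (I.nrm f) ∞ with hA | hA
    · rcases eq_or_ne (J.nrm f) ∞ with hB | hB
      · rw [hA, hB]
      · exact absurd hA (h2 X E f hB.lt_top).1.ne
    · exact le_antisymm (h2 X E f (h1 X E f hA.lt_top).1).2 (h1 X E f hA.lt_top).2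

end BanachLipIdeal

/-- `CLIN_𝒜`: the Banach linear operator ideals that coincide isometrically with `𝒜` on the
finite-dimensional spaces. -/
def CLIN {𝕜 : Type} [RCLike 𝕜] (A : BanachLinIdeal.{u} 𝕜) : Set (BanachLinIdeal.{u} 𝕜) :=
  {B | ∀ (M N : Type u) [NormedAddCommGroup M] [NormedSpace 𝕜 M] [CompleteSpace M]
    [NormedAddCommGroup N] [NormedSpace 𝕜 N] [CompleteSpace N]
    [FiniteDimensional 𝕜 M] [FiniteDimensional 𝕜 N] (T : M →L[𝕜] N), B.nrm T = A.nrm T}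

/-- `CLIP_ℐ`: the Banach Lipschitz operator ideals that coincide isometrically with `ℐ` on the
finite pointed metric spaces and the finite-dimensional spaces. -/
def CLIP {𝕜 : Type} [RCLike 𝕜] (I : BanachLipIdeal.{u} 𝕜) : Set (BanachLipIdeal.{u} 𝕜) :=
  {J | ∀ (X₀ N : Type u) [MetricSpace X₀] [Zero X₀] [Finite X₀] [NormedAddCommGroup N]
    [NormedSpace 𝕜 N] [CompleteSpace N] [FiniteDimensional 𝕜 N] (f : Lip0 X₀ N),
    J.nrm f = I.nrm f}

/-! ### The composition ideal `𝒜 ∘ Lip0` -/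

section Composition

variable {𝕜 : Type} [RCLike 𝕜]

theorem linearization_add {X E : Type*} [MetricSpace X] [Zero X] [NormedAddCommGroup E]
    [NormedSpace 𝕜 E] [CompleteSpace E] (f g : Lip0 X E) :
    linearization 𝕜 (f + g) = linearization 𝕜 f + linearization 𝕜 g :=
  linearization_unique fun x => by simp

theorem linearization_sub {X E : Type*} [MetricSpace X] [Zero X] [NormedAddCommGroup E]
    [NormedSpace 𝕜 E] [CompleteSpace E] (f g : Lip0 X E) :
    linearization 𝕜 (f - g) = linearization 𝕜 f - linearization 𝕜 g :=
  linearization_unique fun x => by simp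

theorem linearization_smul {X E : Type*} [MetricSpace X] [Zero X] [NormedAddCommGroup E]
    [NormedSpace 𝕜 E] [CompleteSpace E] (c : 𝕜) (f : Lip0 X E) :
    linearization 𝕜 (c • f) = c • linearization 𝕜 f :=
  linearization_unique fun x => by simp

theorem linearization_comp_diracAE {X E : Type*} [MetricSpace X] [Zero X] [NormedAddCommGroup E]
    [NormedSpace 𝕜 E] [CompleteSpace E] (T : AE 𝕜 X →L[𝕜] E) :
    linearization 𝕜 ((Lip0.ofLinear T).comp (diracAE 𝕜 X)) = T :=
  linearization_unique fun x => by simp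

/-- `L_{S ∘ f} = S ∘ L_f`. -/
theorem linearization_ofLinear_comp {X E F : Type*} [MetricSpace X] [Zero X]
    [NormedAddCommGroup E] [NormedSpace 𝕜 E] [CompleteSpace E]
    [NormedAddCommGroup F] [NormedSpace 𝕜 F] [CompleteSpace F] (S : E →L[𝕜] F) (f : Lip0 X E) :
    linearization 𝕜 ((Lip0.ofLinear S).comp f) = S ∘L linearization 𝕜 f :=
  linearization_unique fun x => by simp

/-- `L_{f ∘ g} = L_f ∘ ĝ`. -/
theorem linearization_comp {X Y E : Type*} [MetricSpace X] [Zero X] [MetricSpace Y] [Zero Y]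
    [NormedAddCommGroup E] [NormedSpace 𝕜 E] [CompleteSpace E] (f : Lip0 X E) (g : Lip0 Y X) :
    linearization 𝕜 (f.comp g) =
      linearization 𝕜 f ∘L linearization 𝕜 ((diracAE 𝕜 X).comp g) :=
  linearization_unique fun x => by simp

theorem lip_eq_enorm {X E : Type*} [MetricSpace X] [Zero X] [NormedAddCommGroup E]
    (f : Lip0 X E) : (f.lip : ℝ≥0∞) = ‖f‖ₑ := rfl

theorem enorm_linearization {X E : Type*} [MetricSpace X] [Zero X] [NormedAddCommGroup E]
    [NormedSpace 𝕜 E] [CompleteSpace E] (f : Lip0 X E) : ‖linearization 𝕜 f‖ₑ = ‖f‖ₑ := by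
  rw [← ofReal_norm, ← ofReal_norm, norm_linearization]

theorem Lip0.completeSpace (𝕜 : Type) [RCLike 𝕜] (X E : Type*) [MetricSpace X] [Zero X]
    [NormedAddCommGroup E] [NormedSpace 𝕜 E] [CompleteSpace E] : CompleteSpace (Lip0 X E) := by
  refine Metric.complete_of_cauchySeq_tendsto fun u hu => ?_
  have hc : CauchySeq fun n => linearization 𝕜 (u n) := by
    rw [Metric.cauchySeq_iff] at hu ⊢
    intro ε hε
    obtain ⟨K, hK⟩ := hu ε hε
    refine ⟨K, fun m hm n hn => ?_⟩
    rw [dist_eq_norm, ← linearization_sub, norm_linearization, ← dist_eq_norm]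
    exact hK m hm n hn
  obtain ⟨T, hT⟩ := cauchySeq_tendsto_of_complete hc
  refine ⟨(Lip0.ofLinear T).comp (diracAE 𝕜 X), ?_⟩
  rw [tendsto_iff_norm_sub_tendsto_zero] at hT ⊢
  refine hT.congr fun n => ?_
  rw [← norm_linearization (𝕜 := 𝕜) (u n - _), linearization_sub, linearization_comp_diracAE]

/-- The ideal `𝒜 ∘ Lip0`: `‖f‖_{𝒜 ∘ Lip0} = ‖L_f‖_𝒜`. -/
def BanachLinIdeal.compLip0 (A : BanachLinIdeal.{u} 𝕜) : BanachLipIdeal.{u} 𝕜 where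
  nrm f := A.nrm (linearization 𝕜 f)
  banach X E _ _ _ _ _ :=
    { eq_zero := fun f hf => by
        have := (A.banach (AE 𝕜 X) E).eq_zero _ hf
        have h2 := norm_linearization (𝕜 := 𝕜) f
        rw [this, norm_zero] at h2
        exact norm_eq_zero.1 h2.symm
      add_le := fun f g => by
        rw [linearization_add]; exact (A.banach (AE 𝕜 X) E).add_le _ _
      smul := fun c f => by
        rw [linearization_smul]; exact (A.banach (AE 𝕜 X) E).smul _ _
      complete := fun u hu hc => by
        obtain ⟨T, hT, hlim⟩ := (A.banach (AE 𝕜 X) E).complete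
          (fun n => linearization 𝕜 (u n)) hu (by simpa only [linearization_sub] using hc)
        refine ⟨(Lip0.ofLinear T).comp (diracAE 𝕜 X), ?_, ?_⟩
        · rw [linearization_comp_diracAE]; exact hT
        · simpa only [linearization_sub, linearization_comp_diracAE] using hlim }
  lip_le f := by
    rw [lip_eq_enorm, ← enorm_linearization (𝕜 := 𝕜)]; exact A.enorm_le _
  nrm_id := by
    apply le_antisymm
    · have h := A.nrm_comp_le (ContinuousLinearMap.id 𝕜 (ULift.{u} 𝕜))
        (ContinuousLinearMap.id 𝕜 (ULift.{u} 𝕜)) (linearization 𝕜 (Lip0.id (ULift.{u} 𝕜)))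
      rw [A.nrm_id, enorm_linearization, ContinuousLinearMap.id_comp,
        ContinuousLinearMap.id_comp, mul_one] at h
      refine h.trans ?_
      have h1 : ‖ContinuousLinearMap.id 𝕜 (ULift.{u} 𝕜)‖ₑ ≤ 1 := by
        rw [← A.nrm_id]; exact A.enorm_le _
      have h2 : ‖Lip0.id (ULift.{u} 𝕜)‖ₑ ≤ 1 := by
        rw [← lip_eq_enorm]
        exact_mod_cast Lip0.lip_le (f := Lip0.id (ULift.{u} 𝕜)) LipschitzWith.id
      exact (mul_le_mul' h1 h2).trans (one_mul _).le
    · refine le_trans ?_ (A.enorm_le _)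
      rw [enorm_linearization, ← lip_eq_enorm]
      have h3 := (Lip0.id (ULift.{u} 𝕜)).lipschitzWith.edist_le_mul (ULift.up 1) 0
      have h4 : edist (ULift.up (1 : 𝕜)) 0 = 1 := by
        rw [edist_zero_right, ← ofReal_norm, ULift.norm_up, norm_one, ENNReal.ofReal_one]
      rw [Lip0.id_apply, Lip0.id_apply, h4, mul_one] at h3
      exact h3
  nrm_comp_le {Y X E F} _ _ _ _ _ _ _ _ _ _ S f g := by
    rw [linearization_ofLinear_comp, linearization_comp]
    refine (A.nrm_comp_le _ _ _).trans ?_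
    have h0 : ∀ a b c : ℝ≥0∞, a * b * c = c * b * a := fun a b c => by ring
    rw [h0]
    have h1 := (diracAE 𝕜 X).lip_comp_le g
    have h2 : (diracAE 𝕜 X).lip ≤ 1 := by exact_mod_cast norm_diracAE_le 𝕜
    have h3 := h1.trans ((mul_le_mul' h2 le_rfl).trans (one_mul _).le)
    have h4 : ‖linearization 𝕜 ((diracAE 𝕜 X).comp g)‖ₑ ≤ (g.lip : ℝ≥0∞) := by
      rw [enorm_linearization, ← lip_eq_enorm]
      exact_mod_cast h3
    exact mul_le_mul' (mul_le_mul' h4 le_rfl) le_rfl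

/-- `𝒜 ∘ Lip0` consists of the Lipschitz operators that factor as `T ∘ g` with `T ∈ 𝒜` and `g` a
Lipschitz operator into a Banach space. -/
theorem BanachLinIdeal.compLip0_nrm_lt_top_iff (A : BanachLinIdeal.{u} 𝕜) {X E : Type u}
    [MetricSpace X] [Zero X] [NormedAddCommGroup E] [NormedSpace 𝕜 E] [CompleteSpace E]
    (f : Lip0 X E) :
    A.compLip0.nrm f < ∞ ↔ ∃ (F : Type u) (_ : NormedAddCommGroup F) (_ : NormedSpace 𝕜 F)
      (_ : CompleteSpace F) (g : Lip0 X F) (T : F →L[𝕜] E),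
      A.nrm T < ∞ ∧ ∀ x, f x = T (g x) := by
  constructor
  · intro h
    exact ⟨AE 𝕜 X, inferInstance, inferInstance, inferInstance, diracAE 𝕜 X, linearization 𝕜 f, h,
      fun x => (linearization_dirac f x).symm⟩
  · rintro ⟨F, _, _, _, g, T, hT, hf⟩
    have e : linearization 𝕜 f = ContinuousLinearMap.id 𝕜 E ∘L T ∘L linearization 𝕜 g :=
      linearization_unique fun x => by simp [hf]
    change A.nrm (linearization 𝕜 f) < ∞
    rw [e]
    exact (A.nrm_comp_le _ _ _).trans_lt (ENNReal.mul_lt_top (ENNReal.mul_lt_top enorm_lt_top hT)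
      enorm_lt_top)

end Composition

/-! ### Maximal hulls -/

/-- `FIN(E)`: the finite-dimensional subspaces of `E`. -/
structure FinDimSubspace (𝕜 E : Type*) [RCLike 𝕜] [NormedAddCommGroup E] [NormedSpace 𝕜 E] where
  space : Submodule 𝕜 E
  finDim : FiniteDimensional 𝕜 space

/-- `COFIN(F)`: the closed subspaces of `F` of finite codimension. -/
structure CofinSubspace (𝕜 F : Type*) [RCLike 𝕜] [NormedAddCommGroup F] [NormedSpace 𝕜 F] where
  space : Submodule 𝕜 F
  closed : IsClosed (space : Set F)
  finCodim : FiniteDimensional 𝕜 (F ⧸ space)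

/-- `MFIN(X)`: the finite subsets of `X` that contain the distinguished point. -/
structure FinPointedSubset (X : Type*) [Zero X] where
  carrier : Set X
  finite : carrier.Finite
  zero_mem : (0 : X) ∈ carrier

attribute [instance] FinDimSubspace.finDim CofinSubspace.closed CofinSubspace.finCodim

instance {𝕜 E : Type*} [RCLike 𝕜] [NormedAddCommGroup E] [NormedSpace 𝕜 E]
    (M : FinDimSubspace 𝕜 E) : CompleteSpace M.space := FiniteDimensional.complete 𝕜 M.space

instance {X : Type*} [Zero X] (X₀ : FinPointedSubset X) : Zero X₀.carrier := ⟨⟨0, X₀.zero_mem⟩⟩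

/-- The inclusion of a finite pointed subset. -/
def FinPointedSubset.incl {X : Type*} [MetricSpace X] [Zero X] (X₀ : FinPointedSubset X) :
    Lip0 X₀.carrier X :=
  ⟨fun x => x, rfl, 1, LipschitzWith.subtype_val _⟩

section HullAux

variable {𝕜 : Type} [RCLike 𝕜]

theorem norm_mkQL_le {F : Type*} [NormedAddCommGroup F] [NormedSpace 𝕜 F]
    (L : CofinSubspace 𝕜 F) : ‖L.space.mkQL‖ ≤ 1 :=
  ContinuousLinearMap.opNorm_le_bound _ zero_le_one fun x => by
    rw [one_mul]; exact Submodule.Quotient.norm_mk_le L.space x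

theorem enorm_mkQL_le {F : Type*} [NormedAddCommGroup F] [NormedSpace 𝕜 F]
    (L : CofinSubspace 𝕜 F) : ‖L.space.mkQL‖ₑ ≤ 1 := by
  rw [← ofReal_norm]
  exact (ENNReal.ofReal_le_ofReal (norm_mkQL_le L)).trans ENNReal.ofReal_one.le

theorem enorm_subtypeL_le {E : Type*} [NormedAddCommGroup E] [NormedSpace 𝕜 E]
    (M : FinDimSubspace 𝕜 E) : ‖M.space.subtypeL‖ₑ ≤ 1 := by
  rw [← ofReal_norm]
  exact (ENNReal.ofReal_le_ofReal (M.space.norm_subtypeL_le)).trans ENNReal.ofReal_one.le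

theorem norm_lift_le {F G : Type*} [NormedAddCommGroup F] [NormedSpace 𝕜 F]
    [NormedAddCommGroup G] [NormedSpace 𝕜 G] (K : Submodule 𝕜 F) (T : F →L[𝕜] G)
    (h : K ≤ T.ker) : ‖K.liftQL T h‖ ≤ ‖T‖ := by
  refine ContinuousLinearMap.opNorm_le_bound _ (norm_nonneg _) fun x => ?_
  refine le_of_forall_pos_le_add fun ε hε => ?_
  obtain ⟨m, rfl, hm⟩ := Submodule.Quotient.norm_mk_lt x
    (show 0 < ε / (‖T‖ + 1) by positivity)
  have h1 : K.liftQL T h (Submodule.Quotient.mk m) = T m := rfl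
  rw [h1]
  refine (T.le_opNorm m).trans ((mul_le_mul_of_nonneg_left hm.le (norm_nonneg _)).trans ?_)
  rw [mul_add]
  gcongr
  rw [← mul_div_assoc, div_le_iff₀ (by positivity)]
  nlinarith [norm_nonneg T]

/-- Every vector is normed by a finite-codimensional quotient. -/
theorem exists_cofin_norm {F : Type*} [NormedAddCommGroup F] [NormedSpace 𝕜 F] (y : F) :
    ∃ L : CofinSubspace 𝕜 F, ‖y‖ ≤ ‖L.space.mkQL y‖ := by
  obtain ⟨φ, hφ, hy⟩ := exists_dual_vector'' 𝕜 y
  have hfin : FiniteDimensional 𝕜 (F ⧸ φ.toLinearMap.ker) :=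
    φ.toLinearMap.quotKerEquivRange.symm.finiteDimensional
  refine ⟨⟨φ.toLinearMap.ker, φ.isClosed_ker, hfin⟩, ?_⟩
  have h1 : φ.toLinearMap.ker.liftQL φ le_rfl (φ.toLinearMap.ker.mkQL y) = φ y := rfl
  have h2 := ContinuousLinearMap.le_of_opNorm_le _ ((norm_lift_le φ.toLinearMap.ker φ le_rfl).trans hφ)
    (φ.toLinearMap.ker.mkQL y)
  rw [h1, hy, one_mul] at h2
  simpa using h2

/-- The preimage of a finite-codimensional closed subspace. -/
def CofinSubspace.comap {F F₀ : Type*} [NormedAddCommGroup F] [NormedSpace 𝕜 F]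
    [NormedAddCommGroup F₀] [NormedSpace 𝕜 F₀] (R : F →L[𝕜] F₀) (L : CofinSubspace 𝕜 F₀) :
    CofinSubspace 𝕜 F where
  space := L.space.comap R.toLinearMap
  closed := L.closed.preimage R.continuous
  finCodim := by
    have hk : L.space.comap R.toLinearMap = (L.space.mkQ.comp R.toLinearMap).ker := by
      rw [LinearMap.ker_comp, Submodule.ker_mkQ]
    rw [hk]
    exact (L.space.mkQ.comp R.toLinearMap).quotKerEquivRange.symm.finiteDimensional

theorem exists_cofin_factor {F F₀ : Type*} [NormedAddCommGroup F] [NormedSpace 𝕜 F]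
    [NormedAddCommGroup F₀] [NormedSpace 𝕜 F₀] (R : F →L[𝕜] F₀) (L : CofinSubspace 𝕜 F₀) :
    ∃ R' : (F ⧸ (L.comap R).space) →L[𝕜] (F₀ ⧸ L.space), ‖R'‖ₑ ≤ ‖R‖ₑ ∧
      ∀ y, L.space.mkQL (R y) = R' ((L.comap R).space.mkQL y) := by
  have hk : (L.comap R).space ≤ (L.space.mkQL ∘L R).ker := fun y hy =>
    (Submodule.Quotient.mk_eq_zero L.space).2 hy
  refine ⟨(L.comap R).space.liftQL (L.space.mkQL ∘L R) hk, ?_, fun y => rfl⟩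
  rw [← ofReal_norm, ← ofReal_norm]
  refine ENNReal.ofReal_le_ofReal ((norm_lift_le _ _ _).trans ?_)
  refine (ContinuousLinearMap.opNorm_comp_le _ _).trans ?_
  exact (mul_le_mul_of_nonneg_right (norm_mkQL_le L) (norm_nonneg _)).trans (one_mul _).le

end HullAux

namespace BanachLinIdeal

variable {𝕜 : Type} [RCLike 𝕜] (A : BanachLinIdeal.{u} 𝕜)

/-- The norm of the maximal hull:
`‖T‖ = sup {‖q_L ∘ T ∘ i_M‖_𝒜 | M ∈ FIN(E), L ∈ COFIN(F)}`, where `i_M : M → E` is the inclusion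
and `q_L : F → F ⧸ L` the quotient map. -/
def maxHullNrm {E F : Type u} [NormedAddCommGroup E] [NormedSpace 𝕜 E]
    [NormedAddCommGroup F] [NormedSpace 𝕜 F] [CompleteSpace F] (T : E →L[𝕜] F) : ℝ≥0∞ :=
  ⨆ p : FinDimSubspace 𝕜 E × CofinSubspace 𝕜 F,
    A.nrm (p.2.space.mkQL ∘L T ∘L p.1.space.subtypeL)

theorem enorm_le_maxHullNrm {E F : Type u} [NormedAddCommGroup E] [NormedSpace 𝕜 E]
    [NormedAddCommGroup F] [NormedSpace 𝕜 F] [CompleteSpace F] (T : E →L[𝕜] F) :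
    ‖T‖ₑ ≤ A.maxHullNrm T := by
  refine ContinuousLinearMap.opENorm_le_bound _ fun x => ?_
  obtain ⟨L, hL⟩ := exists_cofin_norm (𝕜 := 𝕜) (T x)
  let M : FinDimSubspace 𝕜 E := ⟨Submodule.span 𝕜 {x}, inferInstance⟩
  have hx : x ∈ M.space := Submodule.mem_span_singleton_self x
  have h1 : ‖T x‖ₑ ≤ ‖(L.space.mkQL ∘L T ∘L M.space.subtypeL) ⟨x, hx⟩‖ₑ := by
    rw [← ofReal_norm, ← ofReal_norm]
    exact ENNReal.ofReal_le_ofReal hL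
  refine h1.trans ((ContinuousLinearMap.le_opENorm _ _).trans ?_)
  refine mul_le_mul' ((A.enorm_le _).trans ?_) le_rfl
  exact le_iSup (fun p : FinDimSubspace 𝕜 E × CofinSubspace 𝕜 F =>
    A.nrm (p.2.space.mkQL ∘L T ∘L p.1.space.subtypeL)) (M, L)

/-- The maximal hull `𝒜^max` of `𝒜`. -/
def maxHull : BanachLinIdeal.{u} 𝕜 where
  nrm T := A.maxHullNrm T
  banach E F _ _ _ _ _ _ :=
    IsBanachENorm.iSup (V := E →L[𝕜] F) (ι := FinDimSubspace 𝕜 E × CofinSubspace 𝕜 F)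
      (W := fun p => p.1.space →L[𝕜] (F ⧸ p.2.space))
      (fun p =>
        { toFun := fun T => p.2.space.mkQL ∘L T ∘L p.1.space.subtypeL
          map_add' := fun S T => by ext; simp
          map_smul' := fun c T => by ext; simp })
      (fun p T => by
        refine (ContinuousLinearMap.opNorm_comp_le _ _).trans ?_
        refine (mul_le_mul (norm_mkQL_le p.2) (ContinuousLinearMap.opNorm_comp_le _ _)
          (norm_nonneg _) zero_le_one).trans ?_
        rw [one_mul]
        exact mul_le_of_le_one_right (norm_nonneg _) p.1.space.norm_subtypeL_le)
      (fun p T => A.nrm T) (fun p => A.banach _ _) (fun p T => A.enorm_le T)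
      (fun T => A.enorm_le_maxHullNrm T)
  enorm_le T := A.enorm_le_maxHullNrm T
  nrm_id := by
    apply le_antisymm
    · refine iSup_le fun p => (A.nrm_comp_le _ _ _).trans ?_
      rw [A.nrm_id, mul_one]
      exact (mul_le_mul' (enorm_mkQL_le p.2) (enorm_subtypeL_le p.1)).trans (one_mul _).le
    · refine le_trans ?_ (A.enorm_le_maxHullNrm _)
      have h := (ContinuousLinearMap.id 𝕜 (ULift.{u} 𝕜)).le_opENorm (ULift.up 1)
      have h4 : ‖ULift.up.{u} (1 : 𝕜)‖ₑ = 1 := by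
        rw [← ofReal_norm, ULift.norm_up, norm_one, ENNReal.ofReal_one]
      rwa [ContinuousLinearMap.id_apply, h4, mul_one] at h
  nrm_comp_le {E₀ E F F₀} _ _ _ _ _ _ _ _ _ _ _ _ R T S := by
    refine iSup_le fun p => ?_
    obtain ⟨M, L⟩ := p
    obtain ⟨R', hR', hfac⟩ := exists_cofin_factor R L
    let M' : FinDimSubspace 𝕜 E := ⟨M.space.map S.toLinearMap, inferInstance⟩
    let S' : M.space →L[𝕜] M'.space :=
      (S ∘L M.space.subtypeL).codRestrict M'.space fun x => ⟨x, x.2, rfl⟩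
    have hS' : ‖S'‖ₑ ≤ ‖S‖ₑ := by
      rw [← ofReal_norm, ← ofReal_norm]
      refine ENNReal.ofReal_le_ofReal ?_
      exact ContinuousLinearMap.opNorm_le_bound _ (norm_nonneg _) fun x => S.le_opNorm x
    have e : L.space.mkQL ∘L (R ∘L T ∘L S) ∘L M.space.subtypeL =
        R' ∘L ((L.comap R).space.mkQL ∘L T ∘L M'.space.subtypeL) ∘L S' := by
      ext x
      exact hfac (T (S x))
    change A.nrm (L.space.mkQL ∘L (R ∘L T ∘L S) ∘L M.space.subtypeL) ≤ _
    rw [e]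
    refine (A.nrm_comp_le _ _ _).trans (mul_le_mul' (mul_le_mul' hR' ?_) hS')
    exact le_iSup (fun p : FinDimSubspace 𝕜 E × CofinSubspace 𝕜 F =>
      A.nrm (p.2.space.mkQL ∘L T ∘L p.1.space.subtypeL)) (M', L.comap R)

end BanachLinIdeal

namespace BanachLipIdeal

variable {𝕜 : Type} [RCLike 𝕜] (I : BanachLipIdeal.{u} 𝕜)

/-- The norm of the maximal hull:
`‖f‖ = sup {‖q_L ∘ f ∘ i_{X₀}‖_ℐ | X₀ ∈ MFIN(X), L ∈ COFIN(E)}`, where `i_{X₀} : X₀ → X` is the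
inclusion and `q_L : E → E ⧸ L` the quotient map. -/
def maxHullNrm {X E : Type u} [MetricSpace X] [Zero X] [NormedAddCommGroup E] [NormedSpace 𝕜 E]
    [CompleteSpace E] (f : Lip0 X E) : ℝ≥0∞ :=
  ⨆ p : FinPointedSubset X × CofinSubspace 𝕜 E,
    I.nrm ((Lip0.ofLinear p.2.space.mkQL).comp (f.comp p.1.incl))

theorem enorm_le_maxHullNrm {X E : Type u} [MetricSpace X] [Zero X] [NormedAddCommGroup E]
    [NormedSpace 𝕜 E] [CompleteSpace E] (f : Lip0 X E) : ‖f‖ₑ ≤ I.maxHullNrm f := by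
  rcases eq_or_ne (I.maxHullNrm f) ∞ with h | h
  · rw [h]; exact le_top
  rw [← lip_eq_enorm, ← ENNReal.coe_toNNReal h, ENNReal.coe_le_coe]
  refine Lip0.lip_le fun x y => ?_
  rw [ENNReal.coe_toNNReal h, edist_eq_enorm_sub]
  obtain ⟨L, hL⟩ := exists_cofin_norm (𝕜 := 𝕜) (f x - f y)
  obtain ⟨X₀, hX₀⟩ : ∃ X₀ : FinPointedSubset X, X₀.carrier = {0, x, y} :=
    ⟨⟨{0, x, y}, by simp, by simp⟩, rfl⟩
  let x' : X₀.carrier := ⟨x, by simp [hX₀]⟩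
  let y' : X₀.carrier := ⟨y, by simp [hX₀]⟩
  let g : Lip0 X₀.carrier (E ⧸ L.space) := (Lip0.ofLinear L.space.mkQL).comp (f.comp X₀.incl)
  have h1 : ‖f x - f y‖ₑ ≤ edist (g x') (g y') := by
    rw [edist_eq_enorm_sub, ← ofReal_norm, ← ofReal_norm]
    exact ENNReal.ofReal_le_ofReal hL
  refine h1.trans ((g.lipschitzWith x' y').trans ?_)
  refine mul_le_mul' ((I.lip_le g).trans ?_) le_rfl
  exact le_iSup (fun p : FinPointedSubset X × CofinSubspace 𝕜 E =>
    I.nrm ((Lip0.ofLinear p.2.space.mkQL).comp (f.comp p.1.incl))) (X₀, L)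

/-- The maximal hull `ℐ^max` of `ℐ`. -/
def maxHull : BanachLipIdeal.{u} 𝕜 where
  nrm f := I.maxHullNrm f
  banach X E _ _ _ _ _ :=
    letI := Lip0.completeSpace 𝕜 X E
    IsBanachENorm.iSup (V := Lip0 X E) (ι := FinPointedSubset X × CofinSubspace 𝕜 E)
      (W := fun p => Lip0 p.1.carrier (E ⧸ p.2.space))
      (fun p =>
        { toFun := fun f => (Lip0.ofLinear p.2.space.mkQL).comp (f.comp p.1.incl)
          map_add' := fun f g => by ext; simp
          map_smul' := fun c f => by ext; simp })
      (fun p f => by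
        refine (Lip0.norm_ofLinear_comp_le _ _).trans ?_
        refine (mul_le_mul_of_nonneg_right (norm_mkQL_le p.2) (norm_nonneg _)).trans ?_
        rw [one_mul]
        exact Lip0.norm_le_of (norm_nonneg _) fun x y => f.norm_sub_le_dist x y)
      (fun p f => I.nrm f) (fun p => I.banach _ _) (fun p f => I.lip_le f)
      (fun f => I.enorm_le_maxHullNrm f)
  lip_le f := I.enorm_le_maxHullNrm f
  nrm_id := by
    apply le_antisymm
    · refine iSup_le fun p => (I.nrm_comp_le _ _ _).trans ?_
      rw [I.nrm_id, mul_one]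
      have h : p.1.incl.lip ≤ 1 := Lip0.lip_le (LipschitzWith.subtype_val _)
      exact (mul_le_mul' (by exact_mod_cast h) (enorm_mkQL_le p.2)).trans (one_mul _).le
    · refine le_trans ?_ (I.enorm_le_maxHullNrm _)
      rw [← lip_eq_enorm]
      have h3 := (Lip0.id (ULift.{u} 𝕜)).lipschitzWith.edist_le_mul (ULift.up 1) 0
      have h4 : edist (ULift.up (1 : 𝕜)) 0 = 1 := by
        rw [edist_zero_right, ← ofReal_norm, ULift.norm_up, norm_one, ENNReal.ofReal_one]
      rw [Lip0.id_apply, Lip0.id_apply, h4, mul_one] at h3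
      exact h3
  nrm_comp_le {Y X E F} _ _ _ _ _ _ _ _ _ _ S f g := by
    refine iSup_le fun p => ?_
    obtain ⟨Y₀, L⟩ := p
    obtain ⟨S', hS', hfac⟩ := exists_cofin_factor S L
    obtain ⟨X₀, hX₀⟩ : ∃ X₀ : FinPointedSubset X, ∀ y ∈ Y₀.carrier, g y ∈ X₀.carrier :=
      ⟨⟨g '' Y₀.carrier, Y₀.finite.image g, ⟨0, Y₀.zero_mem, g.map_zero⟩⟩,
        fun y hy => ⟨y, hy, rfl⟩⟩
    have hl : LipschitzWith g.lip
        (fun y : Y₀.carrier => (⟨g y, hX₀ y y.2⟩ : X₀.carrier)) :=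
      fun x y => g.lipschitzWith x y
    let g' : Lip0 Y₀.carrier X₀.carrier :=
      ⟨fun y => ⟨g y, hX₀ y y.2⟩, Subtype.ext g.map_zero, _, hl⟩
    have e : (Lip0.ofLinear L.space.mkQL).comp
          (((Lip0.ofLinear S).comp (f.comp g)).comp Y₀.incl) =
        (Lip0.ofLinear S').comp
          (((Lip0.ofLinear (L.comap S).space.mkQL).comp (f.comp X₀.incl)).comp g') := by
      ext y
      exact hfac (f (g y))
    change I.nrm ((Lip0.ofLinear L.space.mkQL).comp
          (((Lip0.ofLinear S).comp (f.comp g)).comp Y₀.incl)) ≤ _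
    rw [e]
    have hg : g'.lip ≤ g.lip := Lip0.lip_le hl
    refine (I.nrm_comp_le _ _ _).trans
      (mul_le_mul' (mul_le_mul' (by exact_mod_cast hg) ?_) hS')
    exact le_iSup (fun p : FinPointedSubset X × CofinSubspace 𝕜 E =>
      I.nrm ((Lip0.ofLinear p.2.space.mkQL).comp (f.comp p.1.incl))) (X₀, L.comap S)

end BanachLipIdeal

end LipIdeals

end

/-!
If `ℬ` agrees with `𝒜` on finite-dimensional spaces, then `ℬ ∘ Lip0` agrees with `𝒜 ∘ Lip0` for maps
from finite pointed spaces to finite-dimensional spaces, because the Arens–Eells space of a finite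
pointed space is finite-dimensional. As each maximal hull is the greatest ideal with the given
finite part, this gives `𝒜^max ∘ Lip0 ≤ (𝒜 ∘ Lip0)^max`.

For the converse, a finite-dimensional subspace of `Æ(X)` has to be lifted to some `Æ(X₀)` with `X₀`
finite, up to `ε` both in position and in norm. A basis is approximated by combinations of
evaluations, which lie in the image of `Æ(X₀)` for large `X₀`. When `𝕜 = ℂ`, however,
`Æ(X₀) → Æ(X)` need not be isometric, since complex Lipschitz functions on `X₀` need not extend to
`X` with the same constant. What saves the norm estimate is that the norm of a combination of
evaluations in `Æ(X)` is the limit of its norms in `Æ(X₀)` as `X₀` grows: norming functions on the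
`X₀` accumulate, by Tychonoff's theorem, at a contraction on all of `X`. On the compact unit ball of
a finite-dimensional space this limit is uniform.
-/

noncomputable section

namespace LipIdeals

section LinearHull

variable {𝕜 : Type} [RCLike 𝕜]

theorem IsBanachENorm.map_zero {V : Type*} [AddCommGroup V] [Module 𝕜 V] {N : V → ℝ≥0∞}
    (h : IsBanachENorm 𝕜 N) : N 0 = 0 := by
  simpa using h.smul 0 0

theorem enorm_id_le_one (𝕜 E : Type*) [NontriviallyNormedField 𝕜] [SeminormedAddCommGroup E]
    [NormedSpace 𝕜 E] : ‖ContinuousLinearMap.id 𝕜 E‖ₑ ≤ 1 :=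
  ContinuousLinearMap.opENorm_le_bound _ fun x => (one_mul ‖x‖ₑ).ge

theorem CofinSubspace.exists_leftInverse_mkQL (N : Type*) [NormedAddCommGroup N]
    [NormedSpace 𝕜 N] [FiniteDimensional 𝕜 N] :
    ∃ (L : CofinSubspace 𝕜 N) (R : (N ⧸ L.space) →L[𝕜] N),
      ‖R‖ₑ ≤ 1 ∧ ∀ y, R (L.space.mkQL y) = y := by
  let L : CofinSubspace 𝕜 N := ⟨⊥, Submodule.closed_of_finiteDimensional _, inferInstance⟩
  refine ⟨L, L.space.liftQL (ContinuousLinearMap.id 𝕜 N) bot_le, ?_, fun _ => rfl⟩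
  exact (enorm_le_iff_norm_le.2 (norm_lift_le _ _ _)).trans (enorm_id_le_one 𝕜 N)

namespace BanachLinIdeal

variable (A : BanachLinIdeal.{u} 𝕜)
  {E₀ E F F₀ : Type u} [NormedAddCommGroup E₀] [NormedSpace 𝕜 E₀] [CompleteSpace E₀]
  [NormedAddCommGroup E] [NormedSpace 𝕜 E] [CompleteSpace E]
  [NormedAddCommGroup F] [NormedSpace 𝕜 F] [CompleteSpace F]
  [NormedAddCommGroup F₀] [NormedSpace 𝕜 F₀] [CompleteSpace F₀]

theorem nrm_comp_le_left (R : F →L[𝕜] F₀) (T : E →L[𝕜] F) :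
    A.nrm (R ∘L T) ≤ ‖R‖ₑ * A.nrm T :=
  (A.nrm_comp_le R T (ContinuousLinearMap.id 𝕜 E)).trans
    (mul_le_of_le_one_right' (enorm_id_le_one 𝕜 E))

theorem nrm_comp_le_right (T : E →L[𝕜] F) (S : E₀ →L[𝕜] E) :
    A.nrm (T ∘L S) ≤ A.nrm T * ‖S‖ₑ :=
  (A.nrm_comp_le (ContinuousLinearMap.id 𝕜 F) T S).trans
    (mul_le_mul_left (mul_le_of_le_one_left' (enorm_id_le_one 𝕜 F)) _)

theorem nrm_comp_le_nrm {R : F →L[𝕜] F₀} {S : E₀ →L[𝕜] E} (hR : ‖R‖ₑ ≤ 1) (T : E →L[𝕜] F)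
    (hS : ‖S‖ₑ ≤ 1) : A.nrm (R ∘L T ∘L S) ≤ A.nrm T :=
  (A.nrm_comp_le R T S).trans
    (mul_le_of_le_of_le_one (mul_le_of_le_one_left' hR) hS)

theorem nrm_mkQL_comp_subtypeL_le_nrm (T : E →L[𝕜] F) (M : FinDimSubspace 𝕜 E)
    (L : CofinSubspace 𝕜 F) : A.nrm (L.space.mkQL ∘L T ∘L M.space.subtypeL) ≤ A.nrm T :=
  A.nrm_comp_le_nrm (enorm_mkQL_le L) T (enorm_subtypeL_le M)

theorem nrm_mkQL_comp_subtypeL_le_maxHull (T : E →L[𝕜] F) (M : FinDimSubspace 𝕜 E)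
    (L : CofinSubspace 𝕜 F) :
    A.nrm (L.space.mkQL ∘L T ∘L M.space.subtypeL) ≤ A.maxHull.nrm T :=
  le_iSup (fun p : FinDimSubspace 𝕜 E × CofinSubspace 𝕜 F =>
    A.nrm (p.2.space.mkQL ∘L T ∘L p.1.space.subtypeL)) (M, L)

theorem maxHull_mem_CLIN : A.maxHull ∈ CLIN A := by
  intro M N _ _ _ _ _ _ _ _ T
  refine le_antisymm (iSup_le fun p => A.nrm_mkQL_comp_subtypeL_le_nrm T p.1 p.2) ?_
  obtain ⟨L, R, hR, hRL⟩ := CofinSubspace.exists_leftInverse_mkQL (𝕜 := 𝕜) N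
  let M' : FinDimSubspace 𝕜 M := ⟨⊤, inferInstance⟩
  let J : M →L[𝕜] M'.space :=
    (ContinuousLinearMap.id 𝕜 M).codRestrict M'.space fun _ => Submodule.mem_top
  have hJ : ‖J‖ₑ ≤ 1 := J.opENorm_le_bound fun x => (one_mul ‖x‖ₑ).ge
  have hT : T = R ∘L (L.space.mkQL ∘L T ∘L M'.space.subtypeL) ∘L J := by
    ext x
    exact (hRL (T x)).symm
  calc A.nrm T = A.nrm (R ∘L (L.space.mkQL ∘L T ∘L M'.space.subtypeL) ∘L J) := congrArg A.nrm hT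
    _ ≤ A.nrm (L.space.mkQL ∘L T ∘L M'.space.subtypeL) := A.nrm_comp_le_nrm hR _ hJ
    _ ≤ A.maxHull.nrm T := A.nrm_mkQL_comp_subtypeL_le_maxHull T M' L

theorem isGreatest_maxHull : IsGreatest (CLIN A) A.maxHull := by
  refine ⟨A.maxHull_mem_CLIN, fun B hB E F _ _ _ _ _ _ T hT => ?_⟩
  have hle : A.maxHull.nrm T ≤ B.nrm T := iSup_le fun p =>
    (hB _ _ _).ge.trans (B.nrm_mkQL_comp_subtypeL_le_nrm T p.1 p.2)
  exact ⟨hle.trans_lt hT, hle⟩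

theorem nrm_smulRight_lt_top (φ : StrongDual 𝕜 E) (y : F) : A.nrm (φ.smulRight y) < ∞ := by
  let e : ULift.{u} 𝕜 ≃L[𝕜] 𝕜 := ContinuousLinearEquiv.ulift
  have hφy : φ.smulRight y = (ContinuousLinearMap.toSpanSingleton 𝕜 y ∘L e) ∘L
      ContinuousLinearMap.id 𝕜 (ULift.{u} 𝕜) ∘L (e.symm ∘L φ) := by
    ext x
    simp
  rw [hφy]
  refine (A.nrm_comp_le _ _ _).trans_lt ?_
  rw [A.nrm_id, mul_one]
  exact ENNReal.mul_lt_top enorm_lt_top enorm_lt_top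

theorem nrm_id_lt_top (E : Type u) [NormedAddCommGroup E] [NormedSpace 𝕜 E] [CompleteSpace E]
    [FiniteDimensional 𝕜 E] : A.nrm (ContinuousLinearMap.id 𝕜 E) < ∞ := by
  let b := Module.finBasis 𝕜 E
  let P (i) : E →L[𝕜] E := (LinearMap.toContinuousLinearMap (b.coord i)).smulRight (b i)
  have hid : ContinuousLinearMap.id 𝕜 E = ∑ i, P i := by
    ext x
    simp [P, b.sum_repr]
  rw [hid]
  calc A.nrm (∑ i, P i) ≤ ∑ i, A.nrm (P i) :=
        Finset.le_sum_of_subadditive (fun T : E →L[𝕜] E => A.nrm T) (A.banach E E).map_zero.le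
          (A.banach E E).add_le _ _
    _ < ∞ := ENNReal.sum_lt_top.2 fun i _ => A.nrm_smulRight_lt_top _ _

end BanachLinIdeal

end LinearHull

section LipschitzHull

variable {X Y : Type*} [MetricSpace X] [Zero X] [MetricSpace Y] [Zero Y]

theorem FinPointedSubset.lip_incl_le_one (X₀ : FinPointedSubset X) : X₀.incl.lip ≤ 1 :=
  Lip0.lip_le (LipschitzWith.subtype_val _)

/-- A Lipschitz map with values in a finite pointed subset, as a map into that subset. -/
def Lip0.codRestrict (g : Lip0 Y X) (X₀ : FinPointedSubset X) (h : ∀ y, g y ∈ X₀.carrier) :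
    Lip0 Y X₀.carrier :=
  ⟨fun y => ⟨g y, h y⟩, Subtype.ext g.map_zero, g.lip, g.lipschitzWith.subtype_mk h⟩

theorem Lip0.lip_codRestrict_le (g : Lip0 Y X) (X₀ : FinPointedSubset X)
    (h : ∀ y, g y ∈ X₀.carrier) : (g.codRestrict X₀ h).lip ≤ g.lip :=
  Lip0.lip_le (g.lipschitzWith.subtype_mk h)

end LipschitzHull

namespace BanachLipIdeal

variable {𝕜 : Type} [RCLike 𝕜] (I : BanachLipIdeal.{u} 𝕜)
  {X Y E F : Type u} [MetricSpace X] [Zero X] [MetricSpace Y] [Zero Y]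
  [NormedAddCommGroup E] [NormedSpace 𝕜 E] [CompleteSpace E]
  [NormedAddCommGroup F] [NormedSpace 𝕜 F] [CompleteSpace F]

theorem nrm_comp_le_nrm {S : E →L[𝕜] F} {g : Lip0 Y X} (hS : ‖S‖ₑ ≤ 1) (f : Lip0 X E)
    (hg : g.lip ≤ 1) : I.nrm ((Lip0.ofLinear S).comp (f.comp g)) ≤ I.nrm f :=
  (I.nrm_comp_le S f g).trans
    (mul_le_of_le_of_le_one (mul_le_of_le_one_left' (ENNReal.coe_le_one_iff.2 hg)) hS)

theorem nrm_mkQL_comp_incl_le_nrm (f : Lip0 X E) (X₀ : FinPointedSubset X)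
    (L : CofinSubspace 𝕜 E) :
    I.nrm ((Lip0.ofLinear L.space.mkQL).comp (f.comp X₀.incl)) ≤ I.nrm f :=
  I.nrm_comp_le_nrm (enorm_mkQL_le L) f X₀.lip_incl_le_one

theorem nrm_mkQL_comp_incl_le_maxHull (f : Lip0 X E) (X₀ : FinPointedSubset X)
    (L : CofinSubspace 𝕜 E) :
    I.nrm ((Lip0.ofLinear L.space.mkQL).comp (f.comp X₀.incl)) ≤ I.maxHull.nrm f :=
  le_iSup (fun p : FinPointedSubset X × CofinSubspace 𝕜 E =>
    I.nrm ((Lip0.ofLinear p.2.space.mkQL).comp (f.comp p.1.incl))) (X₀, L)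

theorem maxHull_mem_CLIP : I.maxHull ∈ CLIP I := by
  intro X N _ _ _ _ _ _ _ f
  refine le_antisymm (iSup_le fun p => I.nrm_mkQL_comp_incl_le_nrm f p.1 p.2) ?_
  obtain ⟨L, R, hR, hRL⟩ := CofinSubspace.exists_leftInverse_mkQL (𝕜 := 𝕜) N
  obtain ⟨X₀, hX₀⟩ : ∃ X₀ : FinPointedSubset X, ∀ x, x ∈ X₀.carrier :=
    ⟨⟨Set.univ, Set.finite_univ, Set.mem_univ 0⟩, Set.mem_univ⟩
  let J : Lip0 X X₀.carrier := (Lip0.id X).codRestrict X₀ hX₀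
  have hJ : J.lip ≤ 1 :=
    ((Lip0.id X).lip_codRestrict_le X₀ hX₀).trans (Lip0.lip_le LipschitzWith.id)
  let fL := (Lip0.ofLinear L.space.mkQL).comp (f.comp X₀.incl)
  have hf : f = (Lip0.ofLinear R).comp (fL.comp J) := by
    ext x
    exact (hRL (f x)).symm
  calc I.nrm f = I.nrm ((Lip0.ofLinear R).comp (fL.comp J)) := congrArg I.nrm hf
    _ ≤ I.nrm fL := I.nrm_comp_le_nrm hR _ hJ
    _ ≤ I.maxHull.nrm f := I.nrm_mkQL_comp_incl_le_maxHull f X₀ L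

theorem isGreatest_maxHull : IsGreatest (CLIP I) I.maxHull := by
  refine ⟨I.maxHull_mem_CLIP, fun J hJ X E _ _ _ _ _ f hf => ?_⟩
  have hle : I.maxHull.nrm f ≤ J.nrm f := iSup_le fun p => by
    have := p.1.finite.to_subtype
    exact (hJ _ _ _).ge.trans (J.nrm_mkQL_comp_incl_le_nrm f p.1 p.2)
  exact ⟨hle.trans_lt hf, hle⟩

end BanachLipIdeal

section ArensEells

variable {𝕜 : Type} [RCLike 𝕜] {X Y Z : Type*} [MetricSpace X] [Zero X] [MetricSpace Y] [Zero Y]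
  [MetricSpace Z] [Zero Z]

namespace AE

theorem dense_span_range_diracAE :
    Dense (Submodule.span 𝕜 (Set.range (diracAE 𝕜 X)) : Set (AE 𝕜 X)) := by
  let K := (Submodule.span 𝕜 (Set.range (diracAE 𝕜 X))).topologicalClosure
  have : IsClosed (K : Set (AE 𝕜 X)) := Submodule.isClosed_topologicalClosure _
  have hK : K.mkQL = 0 := AE.hom_ext 𝕜 fun x => (Submodule.Quotient.mk_eq_zero K).2 <|
    Submodule.le_topologicalClosure _ (Submodule.subset_span ⟨x, rfl⟩)
  exact fun φ => (Submodule.Quotient.mk_eq_zero K).1 (DFunLike.congr_fun hK φ)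

theorem span_range_diracAE_eq_top [Finite X] :
    Submodule.span 𝕜 (Set.range (diracAE 𝕜 X)) = ⊤ := by
  have := FiniteDimensional.span_of_finite 𝕜 (Set.finite_range (diracAE 𝕜 X))
  exact (Submodule.closed_of_finiteDimensional _).submodule_topologicalClosure_eq.symm.trans
    (Submodule.dense_iff_topologicalClosure_eq_top.1 dense_span_range_diracAE)

instance [Finite X] : FiniteDimensional 𝕜 (AE 𝕜 X) :=
  Module.finite_def.2 (span_range_diracAE_eq_top (𝕜 := 𝕜) (X := X) ▸
    Submodule.fg_span (Set.finite_range _))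

theorem exists_eq_sum_smul_diracAE [Fintype X] (φ : AE 𝕜 X) :
    ∃ a : X → 𝕜, φ = ∑ x, a x • diracAE 𝕜 X x := by
  have hφ : φ ∈ Submodule.span 𝕜 (Set.range (diracAE 𝕜 X)) :=
    span_range_diracAE_eq_top (𝕜 := 𝕜) (X := X) ▸ Submodule.mem_top
  obtain ⟨a, ha⟩ := (Submodule.mem_span_range_iff_exists_fun 𝕜).1 hφ
  exact ⟨a, ha.symm⟩

variable (𝕜) in
/-- The operator between Arens–Eells spaces that linearizes a Lipschitz map `Y → X`. -/
def map (g : Lip0 Y X) : AE 𝕜 Y →L[𝕜] AE 𝕜 X :=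
  linearization 𝕜 ((diracAE 𝕜 X).comp g)

@[simp] theorem map_diracAE (g : Lip0 Y X) (y : Y) :
    map 𝕜 g (diracAE 𝕜 Y y) = diracAE 𝕜 X (g y) :=
  linearization_dirac _ y

theorem map_comp (f : Lip0 X Z) (g : Lip0 Y X) : map 𝕜 (f.comp g) = map 𝕜 f ∘L map 𝕜 g :=
  AE.hom_ext 𝕜 fun y => by simp

theorem norm_map_le (g : Lip0 Y X) : ‖map 𝕜 g‖ ≤ g.lip := by
  rw [map, norm_linearization]
  refine Lip0.norm_le_of g.lip.coe_nonneg fun x y => ?_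
  calc ‖diracAE 𝕜 X (g x) - diracAE 𝕜 X (g y)‖
      ≤ ‖diracAE 𝕜 X‖ * dist (g x) (g y) := (diracAE 𝕜 X).norm_sub_le_dist _ _
    _ ≤ 1 * (g.lip * dist x y) := by
        gcongr
        exacts [norm_diracAE_le 𝕜, g.lipschitzWith.dist_le_mul x y]
    _ = g.lip * dist x y := one_mul _

end AE

end ArensEells

section FinPointedSubset

namespace FinPointedSubset

variable {X : Type*} [Zero X]

theorem carrier_injective : Function.Injective (carrier : FinPointedSubset X → Set X) := by
  rintro ⟨s, _, _⟩ ⟨t, _, _⟩ rfl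
  rfl

instance : LE (FinPointedSubset X) := ⟨fun X₀ X₁ => X₀.carrier ⊆ X₁.carrier⟩

instance : LT (FinPointedSubset X) := ⟨fun X₀ X₁ => X₀.carrier ⊂ X₁.carrier⟩

instance : Max (FinPointedSubset X) :=
  ⟨fun X₀ X₁ => ⟨X₀.carrier ∪ X₁.carrier, X₀.finite.union X₁.finite, Or.inl X₀.zero_mem⟩⟩

instance : SemilatticeSup (FinPointedSubset X) :=
  carrier_injective.semilatticeSup carrier Iff.rfl Iff.rfl fun _ _ => rfl

/-- The finite pointed subset consisting of the distinguished point and the points of a finite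
set. -/
def ofFinite {s : Set X} (hs : s.Finite) : FinPointedSubset X :=
  ⟨insert 0 s, hs.insert 0, Set.mem_insert 0 s⟩

theorem subset_carrier_ofFinite {s : Set X} (hs : s.Finite) : s ⊆ (ofFinite hs).carrier :=
  Set.subset_insert 0 s

instance : Nonempty (FinPointedSubset X) := ⟨ofFinite Set.finite_empty⟩

theorem eventually_mem (x : X) : ∀ᶠ X₀ : FinPointedSubset X in atTop, x ∈ X₀.carrier :=
  eventually_atTop.2 ⟨ofFinite (Set.finite_singleton x), fun _ h =>
    h (subset_carrier_ofFinite _ rfl)⟩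

end FinPointedSubset

theorem exists_mem_lipschitzWith_of_forall_finset {X Y : Type*} [PseudoEMetricSpace X]
    [PseudoEMetricSpace Y] {B : Set (X → Y)} (hB : IsCompact B) {K : ℝ≥0}
    (h : ∀ s : Finset X, ∃ g ∈ B, LipschitzOnWith K g s) : ∃ g ∈ B, LipschitzWith K g := by
  classical
  let L (p : X × X) : Set (X → Y) := {g | edist (g p.1) (g p.2) ≤ K * edist p.1 p.2}
  have hL (p) : IsClosed (L p) :=
    isClosed_le ((continuous_apply p.1).edist (continuous_apply p.2)) continuous_const
  obtain ⟨g, hgB, hg⟩ := hB.inter_iInter_nonempty L hL fun t => by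
    obtain ⟨g, hgB, hg⟩ := h (t.image Prod.fst ∪ t.image Prod.snd)
    refine ⟨g, hgB, Set.mem_iInter₂.2 fun p hp => hg ?_ ?_⟩
    · exact Finset.mem_union_left _ (Finset.mem_image_of_mem _ hp)
    · exact Finset.mem_union_right _ (Finset.mem_image_of_mem _ hp)
  exact ⟨g, hgB, fun x y => Set.mem_iInter.1 hg (x, y)⟩

variable {𝕜 : Type} [RCLike 𝕜] {X Y : Type*} [MetricSpace X] [Zero X] [MetricSpace Y] [Zero Y]

theorem Lip0.exists_extension_norm_le {E : Type*} [NormedAddCommGroup E] {X₀ : FinPointedSubset X}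
    (f : Lip0 X₀.carrier E) :
    ∃ G : X → E, (∀ x : X₀.carrier, G x = f x) ∧ (∀ x, ‖G x‖ ≤ ‖f‖ * dist x 0) ∧
      LipschitzOnWith f.lip G X₀.carrier := by
  let G : X → E := Function.extend Subtype.val f 0
  have hG (x : X₀.carrier) : G x = f x := Subtype.val_injective.extend_apply f 0 x
  refine ⟨G, hG, fun x => ?_, ?_⟩
  · by_cases hx : x ∈ X₀.carrier
    · lift x to X₀.carrier using hx
      rw [hG]
      exact f.norm_apply_le x
    · have hGx : G x = 0 := Function.extend_apply' _ _ _ fun ⟨x₀, hx₀⟩ => hx (hx₀ ▸ x₀.2)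
      rw [hGx, norm_zero]
      positivity
  · have hGf : X₀.carrier.domRestrict G = f := funext hG
    exact lipschitzOnWith_iff_restrict.2 (hGf ▸ f.lipschitzWith)

namespace AE

theorem incl_map_sum_smul_diracAE_apply [Fintype Y] (g : Lip0 Y X) (a : Y → 𝕜) (f : Lip0 X 𝕜) :
    AE.incl 𝕜 X (map 𝕜 g (∑ y, a y • diracAE 𝕜 Y y)) f = ∑ y, a y * f (g y) := by
  simp

theorem le_norm_map_of_forall_lt_norm_map_codRestrict [Finite Y] (g : Lip0 Y X) (φ : AE 𝕜 Y)
    {r : ℝ} (h : ∀ (X₀ : FinPointedSubset X) (hg : ∀ y, g y ∈ X₀.carrier),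
      r < ‖map 𝕜 (g.codRestrict X₀ hg) φ‖) : r ≤ ‖map 𝕜 g φ‖ := by
  cases nonempty_fintype Y
  obtain ⟨a, rfl⟩ := exists_eq_sum_smul_diracAE φ
  let B : Set (X → 𝕜) := (Set.univ.pi fun x => Metric.closedBall 0 (dist x 0)) ∩
    {G | r ≤ ‖∑ y, a y * G (g y)‖}
  have hB : IsCompact B :=
    (isCompact_univ_pi fun x => isCompact_closedBall 0 (dist x 0)).inter_right
      (isClosed_le continuous_const (by fun_prop))
  have hfinite (s : Finset X) : ∃ G ∈ B, LipschitzOnWith 1 G s := by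
    let X₀ := FinPointedSubset.ofFinite (s.finite_toSet.union (Set.finite_range g))
    have hg (y) : g y ∈ X₀.carrier := FinPointedSubset.subset_carrier_ofFinite _ (Or.inr ⟨y, rfl⟩)
    obtain ⟨f, hf, hrf⟩ := ContinuousLinearMap.exists_lt_apply_of_lt_opNorm
      (AE.incl 𝕜 X₀.carrier (map 𝕜 (g.codRestrict X₀ hg) _)) (h X₀ hg)
    rw [incl_map_sum_smul_diracAE_apply] at hrf
    obtain ⟨G, hGf, hGdist, hGlip⟩ := f.exists_extension_norm_le
    refine ⟨G, ⟨fun x _ => ?_, ?_⟩, ?_⟩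
    · rw [mem_closedBall_zero_iff]
      exact (hGdist x).trans (mul_le_of_le_one_left dist_nonneg hf.le)
    · simp only [← hGf] at hrf
      exact hrf.le
    · exact (hGlip.weaken hf.le).mono fun x hx =>
        FinPointedSubset.subset_carrier_ofFinite _ (Or.inl hx)
  obtain ⟨G, ⟨hGB, hGr⟩, hG⟩ := exists_mem_lipschitzWith_of_forall_finset hB hfinite
  have hG0 : G 0 = 0 := by simpa using hGB 0 (Set.mem_univ 0)
  let F : Lip0 X 𝕜 := ⟨G, hG0, 1, hG⟩
  have hF : ‖F‖ ≤ 1 := NNReal.coe_le_coe.2 (Lip0.lip_le (f := F) hG)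
  calc r ≤ ‖AE.incl 𝕜 X (map 𝕜 g (∑ y, a y • diracAE 𝕜 Y y)) F‖ := by
        rw [incl_map_sum_smul_diracAE_apply]
        exact hGr
    _ ≤ ‖map 𝕜 g (∑ y, a y • diracAE 𝕜 Y y)‖ :=
        (AE.incl 𝕜 X _).unit_le_opNorm F hF

theorem norm_map_codRestrict_anti (g : Lip0 Y X) {X₀ X₁ : FinPointedSubset X} (hX : X₀ ≤ X₁)
    (h₀ : ∀ y, g y ∈ X₀.carrier) (h₁ : ∀ y, g y ∈ X₁.carrier) (φ : AE 𝕜 Y) :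
    ‖map 𝕜 (g.codRestrict X₁ h₁) φ‖ ≤ ‖map 𝕜 (g.codRestrict X₀ h₀) φ‖ := by
  let j : Lip0 X₀.carrier X₁.carrier := X₀.incl.codRestrict X₁ fun x => hX x.2
  have hj : ‖map 𝕜 j‖ ≤ 1 :=
    (norm_map_le j).trans ((X₀.incl.lip_codRestrict_le X₁ _).trans X₀.lip_incl_le_one)
  have hg : map 𝕜 (g.codRestrict X₁ h₁) = map 𝕜 j ∘L map 𝕜 (g.codRestrict X₀ h₀) :=
    map_comp j (g.codRestrict X₀ h₀)
  rw [hg]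
  simpa using (map 𝕜 j).le_of_opNorm_le hj (map 𝕜 (g.codRestrict X₀ h₀) φ)

theorem exists_forall_norm_map_codRestrict_lt [Finite Y] (g : Lip0 Y X) {K : Set (AE 𝕜 Y)}
    (hK : IsCompact K) {ε : ℝ} (hε : 0 < ε) :
    ∃ (X₀ : FinPointedSubset X) (hg : ∀ y, g y ∈ X₀.carrier),
      ∀ φ ∈ K, ‖map 𝕜 (g.codRestrict X₀ hg) φ‖ < ‖map 𝕜 g φ‖ + ε := by
  let U (p : {X₀ : FinPointedSubset X // ∀ y, g y ∈ X₀.carrier}) : Set (AE 𝕜 Y) :=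
    {φ | ‖map 𝕜 (g.codRestrict p.1 p.2) φ‖ < ‖map 𝕜 g φ‖ + ε}
  have : Nonempty {X₀ : FinPointedSubset X // ∀ y, g y ∈ X₀.carrier} :=
    ⟨.ofFinite (Set.finite_range g), fun y => FinPointedSubset.subset_carrier_ofFinite _ ⟨y, rfl⟩⟩
  have hUopen (p) : IsOpen (U p) := isOpen_lt (by fun_prop) (by fun_prop)
  have hUcover : K ⊆ ⋃ p, U p := by
    intro φ _
    by_contra hφ
    have hle := le_norm_map_of_forall_lt_norm_map_codRestrict g φ (r := ‖map 𝕜 g φ‖ + ε / 2)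
      fun X₀ hg => by
        have hnot : ¬‖map 𝕜 (g.codRestrict X₀ hg) φ‖ < ‖map 𝕜 g φ‖ + ε :=
          fun h => hφ (Set.mem_iUnion.2 ⟨⟨X₀, hg⟩, h⟩)
        linarith
    linarith
  have hUdirected : Directed (· ⊆ ·) U := fun p q =>
    ⟨⟨p.1 ⊔ q.1, fun y => Or.inl (p.2 y)⟩,
      fun φ hφ => (norm_map_codRestrict_anti g le_sup_left p.2 _ φ).trans_lt hφ,
      fun φ hφ => (norm_map_codRestrict_anti g le_sup_right q.2 _ φ).trans_lt hφ⟩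
  obtain ⟨p, hp⟩ := hK.elim_directed_cover U hUopen hUcover hUdirected
  exact ⟨p.1, p.2, hp⟩

theorem eventually_mem_range_map_incl {φ : AE 𝕜 X}
    (hφ : φ ∈ Submodule.span 𝕜 (Set.range (diracAE 𝕜 X))) :
    ∀ᶠ X₀ : FinPointedSubset X in atTop, φ ∈ (map 𝕜 X₀.incl).range := by
  induction hφ using Submodule.span_induction with
  | mem φ hφ =>
    obtain ⟨x, rfl⟩ := hφ
    filter_upwards [FinPointedSubset.eventually_mem x] with X₀ hx
    exact ⟨diracAE 𝕜 X₀.carrier ⟨x, hx⟩, map_diracAE _ _⟩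
  | zero => exact .of_forall fun X₀ => zero_mem _
  | add φ ψ _ _ hφ hψ =>
    filter_upwards [hφ, hψ] with X₀ using add_mem
  | smul c φ _ hφ =>
    filter_upwards [hφ] with X₀ using Submodule.smul_mem _ c

variable {M : Type*} [NormedAddCommGroup M] [NormedSpace 𝕜 M] [FiniteDimensional 𝕜 M]

theorem exists_norm_sub_map_incl_comp_le (i : M →L[𝕜] AE 𝕜 X) {ε : ℝ} (hε : 0 < ε) :
    ∃ (X₀ : FinPointedSubset X) (R : M →L[𝕜] AE 𝕜 X₀.carrier),
      ‖i - map 𝕜 X₀.incl ∘L R‖ ≤ ε := by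
  let b := Module.finBasis 𝕜 M
  obtain ⟨C, hC, hb⟩ := b.exists_opNorm_le (F := AE 𝕜 X)
  choose u hu hiu using fun k => Metric.dense_iff.1 (dense_span_range_diracAE (𝕜 := 𝕜) (X := X))
    (i (b k)) (ε / C) (by positivity)
  obtain ⟨X₀, hX₀⟩ := (eventually_all.2 fun k => eventually_mem_range_map_incl (hiu k)).exists
  choose v hv using hX₀
  refine ⟨X₀, LinearMap.toContinuousLinearMap (b.constr 𝕜 v), ?_⟩
  refine (hb (by positivity) fun k => ?_).trans (mul_div_cancel₀ ε hC.ne').le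
  have hvk : map 𝕜 X₀.incl (b.constr 𝕜 v (b k)) = u k :=
    (congrArg (map 𝕜 X₀.incl) (b.constr_basis 𝕜 v k)).trans (hv k)
  calc ‖i (b k) - map 𝕜 X₀.incl (b.constr 𝕜 v (b k))‖ = dist (u k) (i (b k)) := by
        rw [hvk, dist_eq_norm']
    _ ≤ ε / C := (hu k).le

theorem exists_norm_le_norm_sub_map_incl_comp_le (i : M →L[𝕜] AE 𝕜 X) {ε : ℝ} (hε : 0 < ε) :
    ∃ (X₀ : FinPointedSubset X) (S : M →L[𝕜] AE 𝕜 X₀.carrier),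
      ‖S‖ ≤ ‖i‖ + ε ∧ ‖i - map 𝕜 X₀.incl ∘L S‖ ≤ ε := by
  obtain ⟨X₁, R, hR⟩ := exists_norm_sub_map_incl_comp_le i (half_pos hε)
  have := X₁.finite.to_subtype
  have := FiniteDimensional.proper 𝕜 M
  obtain ⟨X₀, hX, hX₀⟩ := exists_forall_norm_map_codRestrict_lt (𝕜 := 𝕜) X₁.incl
    ((isCompact_closedBall (0 : M) 1).image R.continuous) (half_pos hε)
  let S : M →L[𝕜] AE 𝕜 X₀.carrier := map 𝕜 (X₁.incl.codRestrict X₀ hX) ∘L R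
  have hS : map 𝕜 X₀.incl ∘L S = map 𝕜 X₁.incl ∘L R := by
    rw [← ContinuousLinearMap.comp_assoc, ← map_comp]
    rfl
  refine ⟨X₀, S, S.opNorm_le_of_unit_norm (by positivity) fun m hm => ?_, ?_⟩
  · calc ‖S m‖ ≤ ‖map 𝕜 X₁.incl (R m)‖ + ε / 2 :=
          (hX₀ _ ⟨m, mem_closedBall_zero_iff.2 hm.le, rfl⟩).le
      _ ≤ ‖i m‖ + ‖(i - map 𝕜 X₁.incl ∘L R) m‖ + ε / 2 := by
          gcongr
          exact norm_le_insert _ _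
      _ ≤ ‖i‖ + ε / 2 + ε / 2 := by
          gcongr
          · exact i.unit_le_opNorm m hm.le
          · exact ((i - map 𝕜 X₁.incl ∘L R).unit_le_opNorm m hm.le).trans hR
      _ = ‖i‖ + ε := by ring
  · rw [hS]
    exact hR.trans (half_le_self hε.le)

end AE

end FinPointedSubset

namespace BanachLinIdeal

variable {𝕜 : Type} [RCLike 𝕜] (A : BanachLinIdeal.{u} 𝕜)
  {E F G M X : Type u} [NormedAddCommGroup E] [NormedSpace 𝕜 E] [CompleteSpace E]
  [NormedAddCommGroup F] [NormedSpace 𝕜 F]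
  [NormedAddCommGroup G] [NormedSpace 𝕜 G] [CompleteSpace G]
  [NormedAddCommGroup M] [NormedSpace 𝕜 M] [CompleteSpace M]
  [MetricSpace X] [Zero X]

theorem nrm_comp_le_add (T : F →L[𝕜] G) (i : M →L[𝕜] F) (j : E →L[𝕜] F) (S : M →L[𝕜] E) :
    A.nrm (T ∘L i) ≤ A.nrm (T ∘L j) * ‖S‖ₑ +
      ‖T‖ₑ * ‖i - j ∘L S‖ₑ * A.nrm (ContinuousLinearMap.id 𝕜 M) := by
  have hi : T ∘L i = (T ∘L j) ∘L S + (T ∘L (i - j ∘L S)) ∘L ContinuousLinearMap.id 𝕜 M := by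
    ext m
    simp
  rw [hi]
  refine ((A.banach M G).add_le _ _).trans (add_le_add (A.nrm_comp_le_right _ _) ?_)
  refine (A.nrm_comp_le_left _ _).trans ?_
  gcongr
  exact ContinuousLinearMap.opENorm_comp_le _ _

theorem nrm_comp_le_of_forall_nrm_comp_map_incl_le [FiniteDimensional 𝕜 M] {i : M →L[𝕜] AE 𝕜 X}
    (hi : ‖i‖ₑ ≤ 1) (T : AE 𝕜 X →L[𝕜] E) {C : ℝ≥0∞}
    (hT : ∀ X₀ : FinPointedSubset X, A.nrm (T ∘L AE.map 𝕜 X₀.incl) ≤ C) :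
    A.nrm (T ∘L i) ≤ C := by
  rcases eq_or_ne C ∞ with rfl | hC
  · exact le_top
  let K : ℝ≥0∞ := C + ‖T‖ₑ * A.nrm (ContinuousLinearMap.id 𝕜 M)
  have hK : K ≠ ∞ :=
    ENNReal.add_ne_top.2 ⟨hC, ENNReal.mul_ne_top enorm_ne_top (A.nrm_id_lt_top M).ne⟩
  refine ENNReal.le_of_forall_pos_le_add fun δ hδ _ => ?_
  obtain ⟨ε, hε, hεK⟩ := ENNReal.exists_nnreal_pos_mul_lt hK (ENNReal.coe_ne_zero.2 hδ.ne')
  obtain ⟨X₀, S, hS, hiS⟩ := AE.exists_norm_le_norm_sub_map_incl_comp_le i (NNReal.coe_pos.2 hε)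
  have hS' : ‖S‖ₑ ≤ 1 + ε := by
    calc ‖S‖ₑ ≤ ‖i‖ₑ + ε := ENNReal.coe_le_coe.2 hS
      _ ≤ 1 + ε := by gcongr
  have hiS' : ‖i - AE.map 𝕜 X₀.incl ∘L S‖ₑ ≤ ε := enorm_le_coe.2 hiS
  calc A.nrm (T ∘L i)
      ≤ A.nrm (T ∘L AE.map 𝕜 X₀.incl) * ‖S‖ₑ + ‖T‖ₑ * ‖i - AE.map 𝕜 X₀.incl ∘L S‖ₑ *
          A.nrm (ContinuousLinearMap.id 𝕜 M) := A.nrm_comp_le_add T i _ S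
    _ ≤ C * (1 + ε) + ‖T‖ₑ * ε * A.nrm (ContinuousLinearMap.id 𝕜 M) := by
        gcongr
        exact hT X₀
    _ = C + ε * K := by ring
    _ ≤ C + δ := by gcongr

variable {A} in
theorem compLip0_mem_CLIP {B : BanachLinIdeal.{u} 𝕜} (hB : B ∈ CLIN A) :
    B.compLip0 ∈ CLIP A.compLip0 :=
  fun _ _ _ _ _ _ _ _ _ f => hB _ _ (linearization 𝕜 f)

theorem compLip0_nrm_mkQL_comp_incl (f : Lip0 X E) (X₀ : FinPointedSubset X)
    (L : CofinSubspace 𝕜 E) :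
    A.compLip0.nrm ((Lip0.ofLinear L.space.mkQL).comp (f.comp X₀.incl)) =
      A.nrm ((L.space.mkQL ∘L linearization 𝕜 f) ∘L AE.map 𝕜 X₀.incl) := by
  refine congrArg A.nrm ?_
  rw [linearization_ofLinear_comp, linearization_comp]
  rfl

theorem compLip0_maxHull : A.compLip0.maxHull = A.maxHull.compLip0 := by
  refine BanachLipIdeal.nrm_injective fun X E _ _ _ _ _ f => le_antisymm ?_ ?_
  · rcases eq_top_or_lt_top (A.maxHull.compLip0.nrm f) with hf | hf
    · exact hf ▸ le_top
    exact (A.compLip0.isGreatest_maxHull.2 (compLip0_mem_CLIP A.maxHull_mem_CLIN) X E f hf).2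
  · refine iSup_le fun p =>
      A.nrm_comp_le_of_forall_nrm_comp_map_incl_le (enorm_subtypeL_le p.1)
        (p.2.space.mkQL ∘L linearization 𝕜 f) fun X₀ => ?_
    rw [← compLip0_nrm_mkQL_comp_incl]
    exact A.compLip0.nrm_mkQL_comp_incl_le_maxHull f X₀ p.2

end BanachLinIdeal

end LipIdeals

end

theorem mainTheorem5 (𝕜 : Type) [RCLike 𝕜] (A : LipIdeals.BanachLinIdeal.{u} 𝕜) :
    -- `(𝒜 ∘ Lip0)^max = 𝒜^max ∘ Lip0` isometrically
    A.compLip0.maxHull = A.maxHull.compLip0 ∧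
    -- `𝒜^max = ⋁ CLIN_𝒜`, and it belongs to `CLIN_𝒜`
    (IsLUB (LipIdeals.CLIN A) A.maxHull ∧ A.maxHull ∈ LipIdeals.CLIN A) ∧
    -- `(𝒜 ∘ Lip0)^max = ⋁ CLIP_{𝒜 ∘ Lip0}`, and it belongs to `CLIP_{𝒜 ∘ Lip0}`
    (IsLUB (LipIdeals.CLIP A.compLip0) A.compLip0.maxHull ∧
      A.compLip0.maxHull ∈ LipIdeals.CLIP A.compLip0) ∧
    -- `(𝒜 ∘ Lip0)^max = ψ(⋁ CLIN_𝒜)` with `ψ(ℬ) = ℬ ∘ Lip0`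
    (∀ S : LipIdeals.BanachLinIdeal.{u} 𝕜, IsLUB (LipIdeals.CLIN A) S →
      A.compLip0.maxHull = S.compLip0) := by
  exact ⟨A.compLip0_maxHull, ⟨A.isGreatest_maxHull.isLUB, A.maxHull_mem_CLIN⟩,
    ⟨A.compLip0.isGreatest_maxHull.isLUB, A.compLip0.maxHull_mem_CLIP⟩, fun S hS => by
      rw [hS.unique A.isGreatest_maxHull.isLUB, A.compLip0_maxHull]⟩
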